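/- **Setting.** Let $X$ be a finite $d$-dimensional graded poset with levels $X(0),\dots,X(d)$, a unique minimal element, and all maximal elements of rank $d$. Assume $X$ is regular: every $x\in X(i)$ covers the same number of elements, and for $x\in X(i)$, $y\in X(k)$, $x<y$, the number of chains $x=x_i<x_{i+1}<\dots<x_k=y$ with $x_j\in X(j)$ depends only on $i,k$. Let $R(k,i)$ be the number of elements of $X(i)$ that are $\le$ a given element of $X(k)$, and $R_{\max}=\max_{0\le i\le k}R(k,i)$. Let $\pi_i$ be fully supported probability distributions on $X(i)$ with $\pi_i(x)=\frac1{R(i+1,i)}\sum_{y\gtrdot x}\pi_{i+1}(y)$. Let $C_i$ be the space of functions $X(i)\to\mathbb R$ with inner product $\langle f,g\rangle=\sum_x\pi_i(x)f(x)g(x)$, and let $$U_if(y)=\frac1{R(i+1,i)}\sum_{x\lessdot y}f(x),\qquad D_{i+1}f(x)=\frac{\sum_{y\gtrdot x}\pi_{i+1}(y)f(y)}{\sum_{y\gtrdot x}\pi_{i+1}(y)},\qquad U^k_\ell=U_{k-1}\cdots U_\ell .$$ Put $H^0=C_0$, $H^i=\ker D_i$ $(i\ge1)$, $V_k^\ell=U^k_\ell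 H^\ell$. Let $\delta_1,\dots,\delta_{d-1}\in[0,1]$, $0\le\gamma<1$, $\delta_0=0$, and assume $X$ is a $(\delta,\gamma)$-eposet: $\|D_{i+1}U_i-(1-\delta_i)I-\delta_iU_{i-1}D_i\|\le\gamma$ for $1\le i\le d-1$. It is called $\gamma$-non-lazy if all diagonal entries of $U_{i-1}D_i$, $1\le i\le d$, are at most $\gamma$. A pure walk $Y:C_k\to C_k$ of height $h(Y)$ is a composition of $h(Y)$ operators $U$ and $h(Y)$ operators $D$ passing only through $C_0,\dots,C_d$. If its $s$-th $D$ (in the order of application) stands at position $i_s$, it maps into $C_{m_s}$ with $m_s=k-2s+i_s$. An HD-walk on $X(k)$ is a stochastic self-adjoint affine combination $M=\sum_Y\alpha_YY$ of finitely many pure walks; $h(M)$ is the maximal $h(Y)$ with $\alpha_Y\ne0$ and $w(M)=\sum_Y|\alpha_Y|$. For $0\le\ell\le k$ let $$\lambda_{Y,\delta,\ell}=\prod_{s=1}^{h(Y)}\Bigl(1-\prod_{i=\ell}^{m_s}\delta_i\Bigr),\qquad \lambda_\ell(M)=\sum_Y\alpha_Y\lambda_{Y,\delta,\ell}$$ (empty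 products are $1$; in particular $\lambda_0(M)=1$). **Theorem.** There are absolute constants $c_0,C>0$ such that the following holds for all such $X,\pi,\delta,\gamma$ and all $1\le k\le d$. (1) For every pure walk $Y$ on $C_k$ of height $j$, every $0\le\ell\le k$ and $g_\ell\in H^\ell$, with $f_\ell=U^k_\ell g_\ell$, $$\|Yf_\ell-\lambda_{Y,\delta,\ell}f_\ell\|\le\|g_\ell\|\sum_{s=1}^{j}\Bigl(\gamma\sum_{r=\ell+1}^{m_s+1}\prod_{i=r}^{m_s}\delta_i\Bigr)\prod_{t<s}\Bigl(1-\prod_{i=\ell}^{m_t}\delta_i\Bigr)\le(j+k)\,j\,\gamma\,\|g_\ell\|.$$ Assume from now on that $X$ is $\gamma$-non-lazy and $\gamma\le c_0\,\dfrac{\max_{1\le i\le d-1}\delta_i(1-\delta_{i-1})}{k^5R_{\max}^2}$ (the maximum being read as $0$ if $d=1$). (2) $C_k=V_k^0\oplus\dots\oplus V_k^k$, and for every HD-walk $M$ on $X(k)$, every $0\le\ell\le k$ and $f_\ell\in V_k^\ell$, $$\|Mf_\ell-\lambda_\ell(M)f_\ell\|\le c_\ell\,\gamma\,\|f_\ell\|,\qquad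 c_\ell=C\,(h(M)+k)\,h(M)\,R(k,\ell)\,w(M).$$ (3) If $c_\ell\gamma+c_{\ell'}\gamma<|\lambda_\ell(M)-\lambda_{\ell'}(M)|$ for all $1\le\ell\ne\ell'\le k$, then $\mathrm{Spec}(M)\subseteq\{1\}\cup\bigcup_{\ell=1}^k[\lambda_\ell(M)-c_\ell\gamma,\ \lambda_\ell(M)+c_\ell\gamma]$. (4) Without this separation assumption, $\mathrm{Spec}(M)\subseteq\{1\}\cup\bigcup_{\ell=1}^k[\lambda_\ell(M)-e,\ \lambda_\ell(M)+e]$ with $e=C\,k\,(h(M)+k)\,h(M)\,R_{\max}\,w(M)\,\gamma$. -/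

import Mathlib

open scoped BigOperators

namespace EPoset

universe u

/-! ### Graded posets and regularity

A graded poset is a finite partial order with Mathlib's `GradeMinOrder ℕ X`: the rank `grade ℕ` is
strictly monotone, increases by one along cover relations, and is `0` at minimal elements. -/

/-- The level `X(i)`: the elements of rank `i`. -/
abbrev Level (X : Type u) [PartialOrder X] [GradeMinOrder ℕ X] (i : ℕ) : Type u :=
  {x : X // grade ℕ x = i}

/-- The space `C_i` of real functions on `X(i)`. -/
abbrev Cochain (X : Type u) [PartialOrder X] [GradeMinOrder ℕ X] (i : ℕ) : Type u :=
  Level X i → ℝ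

open Classical in
/-- The regularity function `R(k,i)`: the number of `y ∈ X(i)` with `y ≤ x`, for `x ∈ X(k)`. In a
regular poset this number does not depend on `x`, so that the supremum is its common value. Since
`≤` is used, `R(i,i) = 1` and `R(k,i) = 0` for `k < i`. -/
noncomputable def regularity (X : Type u) [Fintype X] [PartialOrder X] [GradeMinOrder ℕ X]
    (k i : ℕ) : ℕ :=
  Finset.univ.sup fun x : Level X k =>
    (Finset.univ.filter fun y : Level X i => y.1 ≤ x.1).card

/-- `R_max = max_{0 ≤ i ≤ k} R(k,i)`. -/
noncomputable def regularityMax (X : Type u) [Fintype X] [PartialOrder X] [GradeMinOrder ℕ X]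
    (k : ℕ) : ℕ :=
  (Finset.range (k + 1)).sup fun i => regularity X k i

/-- The chains `x = x_i < x_{i+1} < ⋯ < x_k = y` with `x_j ∈ X(j)`, where `k = i + n`. -/
def FlagBetween {X : Type u} [PartialOrder X] [GradeMinOrder ℕ X] (i n : ℕ) (x y : X) : Type u :=
  {c : Fin (n + 1) → X //
    StrictMono c ∧ c 0 = x ∧ c (Fin.last n) = y ∧ ∀ j : Fin (n + 1), grade ℕ (c j) = i + j}

open Classical in
/-- A pure `d`-dimensional graded poset with a unique minimal element that is regular, i.e.
downward regular and middle regular. -/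
structure IsRegularPoset (X : Type u) [Fintype X] [PartialOrder X] [GradeMinOrder ℕ X]
    (d : ℕ) : Prop where
  existsUnique_min : ∃! b : X, IsMin b
  pure : ∀ x : X, IsMax x → grade ℕ x = d
  downward : ∀ i ≤ d, ∃ r : ℕ, ∀ x : Level X i,
    (Finset.univ.filter fun y : X => y ⋖ x.1).card = r
  middle : ∀ i n : ℕ, i + n ≤ d → ∃ m : ℕ, ∀ (x : Level X i) (y : Level X (i + n)),
    x.1 < y.1 → Nat.card (FlagBetween i n x.1 y.1) = m

/-! ### Measured posets and the averaging operators -/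

open Classical in
/-- `wt x = π_i(x)` for `x ∈ X(i)`: every `π_i` is a (fully supported) probability distribution on
`X(i)`, and `π_i` is induced by `π_{i+1}`. -/
structure IsMeasured (X : Type u) [Fintype X] [PartialOrder X] [GradeMinOrder ℕ X]
    (d : ℕ) (wt : X → ℝ) : Prop where
  pos : ∀ x, 0 < wt x
  sum_eq_one : ∀ i ≤ d, ∑ x : Level X i, wt x.1 = 1
  induced : ∀ i < d, ∀ x : Level X i,
    wt x.1 = (regularity X (i + 1) i : ℝ)⁻¹ *
      ∑ y ∈ Finset.univ.filter (fun y : Level X (i + 1) => x.1 ⋖ y.1), wt y.1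

open Classical in
/-- The up operator `U_i : C_i → C_{i+1}`. -/
noncomputable def up {X : Type u} [Fintype X] [PartialOrder X] [GradeMinOrder ℕ X]
    (i : ℕ) : Cochain X i →ₗ[ℝ] Cochain X (i + 1) where
  toFun f y := (regularity X (i + 1) i : ℝ)⁻¹ *
    ∑ x ∈ Finset.univ.filter (fun x : Level X i => x.1 ⋖ y.1), f x
  map_add' f g := by
    funext y
    simp [Finset.sum_add_distrib, mul_add]
  map_smul' c f := by
    funext y
    simp [← Finset.mul_sum, mul_left_comm]

open Classical in
/-- The down operator `D_{i+1} : C_{i+1} → C_i` (indexed by the level `i` of its target). -/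
noncomputable def down {X : Type u} [Fintype X] [PartialOrder X] [GradeMinOrder ℕ X]
    (wt : X → ℝ) (i : ℕ) : Cochain X (i + 1) →ₗ[ℝ] Cochain X i where
  toFun f x :=
    (∑ y ∈ Finset.univ.filter (fun y : Level X (i + 1) => x.1 ⋖ y.1), wt y.1)⁻¹ *
      ∑ y ∈ Finset.univ.filter (fun y : Level X (i + 1) => x.1 ⋖ y.1), wt y.1 * f y
  map_add' f g := by
    funext x
    simp [Finset.sum_add_distrib, mul_add]
  map_smul' c f := by
    funext x
    simp only [Pi.smul_apply, smul_eq_mul, RingHom.id_apply, mul_left_comm _ c, ← Finset.mul_sum]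

/-- The composition `U^k_ℓ = U_{k-1} ∘ ⋯ ∘ U_ℓ : C_ℓ → C_k` for `ℓ ≤ k`. -/
noncomputable def upIter {X : Type u} [Fintype X] [PartialOrder X] [GradeMinOrder ℕ X]
    {l k : ℕ} (h : l ≤ k) : Cochain X l →ₗ[ℝ] Cochain X k :=
  Nat.leRec (motive := fun m _ => Cochain X l →ₗ[ℝ] Cochain X m)
    LinearMap.id (fun m _ T => (up m).comp T) h

/-- The inner product `⟨f,g⟩ = ∑_{x ∈ X(i)} π_i(x) f(x) g(x)` on `C_i`. -/
noncomputable def ip {X : Type u} [Fintype X] [PartialOrder X] [GradeMinOrder ℕ X]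
    (wt : X → ℝ) {i : ℕ} (f g : Cochain X i) : ℝ :=
  ∑ x : Level X i, wt x.1 * f x * g x

/-- The norm on `C_i` of the inner product `ip`. -/
noncomputable def nrm {X : Type u} [Fintype X] [PartialOrder X] [GradeMinOrder ℕ X]
    (wt : X → ℝ) {i : ℕ} (f : Cochain X i) : ℝ :=
  Real.sqrt (ip wt f f)

/-! ### Expanding posets and the HD-Level-Set Decomposition -/

/-- `(δ,γ)`-eposets: for `1 ≤ j ≤ d - 1` (below `j = i + 1`) the operator norm of
`D_{j+1} U_j - (1 - δ_j) I - δ_j U_{j-1} D_j` on `C_j` is at most `γ`. The parameters are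
`δ_1, …, δ_{d-1} ∈ [0,1]`; by convention `δ_0 = 0`, in accordance with `D_1 U_0 = I`. -/
structure IsEposet (X : Type u) [Fintype X] [PartialOrder X] [GradeMinOrder ℕ X]
    (d : ℕ) (wt : X → ℝ) (δ : ℕ → ℝ) (γ : ℝ) : Prop where
  delta_zero : δ 0 = 0
  delta_mem : ∀ i, 1 ≤ i → i < d → δ i ∈ Set.Icc (0 : ℝ) 1
  gamma_nonneg : 0 ≤ γ
  gamma_lt_one : γ < 1
  expanding : ∀ i, i + 1 < d → ∀ f : Cochain X (i + 1),
    nrm wt (down wt (i + 1) (up (i + 1) f) - (1 - δ (i + 1)) • f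
      - δ (i + 1) • up i (down wt i f)) ≤ γ * nrm wt f

open Classical in
/-- `β`-non-laziness: all diagonal entries of the lower walks `U_{i-1} D_i`, `1 ≤ i ≤ d`, are at
most `β`. -/
def IsNonLazy (X : Type u) [Fintype X] [PartialOrder X] [GradeMinOrder ℕ X]
    (d : ℕ) (wt : X → ℝ) (β : ℝ) : Prop :=
  ∀ i < d, ∀ s : Level X (i + 1), up i (down wt i (Pi.single s (1 : ℝ))) s ≤ β

/-- `H^0 = C_0` and `H^i = ker D_i` for `i ≥ 1`. -/
noncomputable def kerSpace {X : Type u} [Fintype X] [PartialOrder X] [GradeMinOrder ℕ X]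
    (wt : X → ℝ) : (i : ℕ) → Submodule ℝ (Cochain X i)
  | 0 => ⊤
  | i + 1 => LinearMap.ker (down wt i)

/-- `V_k^ℓ = U^k_ℓ H^ℓ`. -/
noncomputable def levelSet {X : Type u} [Fintype X] [PartialOrder X] [GradeMinOrder ℕ X]
    (wt : X → ℝ) {l k : ℕ} (h : l ≤ k) : Submodule ℝ (Cochain X k) :=
  (kerSpace wt l).map (upIter h)

/-! ### Pure walks and HD-walks -/

/-- Words in `U` and `D` leading from level `a` to level `b`; the last letter is the operator that
is applied last. A `k`-dimensional pure walk is an element of `Walk k k`. -/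
inductive Walk (a : ℕ) : ℕ → Type
  | nil : Walk a a
  | stepUp {b : ℕ} (w : Walk a b) : Walk a (b + 1)
  | stepDown {b : ℕ} (w : Walk a (b + 1)) : Walk a b

namespace Walk

/-- The highest level that is visited; on a `d`-dimensional poset it has to be at most `d`. -/
def top {a : ℕ} : {b : ℕ} → Walk a b → ℕ
  | _, nil => a
  | _, @stepUp _ b w => max w.top (b + 1)
  | _, stepDown w => w.top

/-- The number of `U`'s. -/
def ups {a : ℕ} : {b : ℕ} → Walk a b → ℕ
  | _, nil => 0
  | _, stepUp w => w.ups + 1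
  | _, stepDown w => w.ups

/-- The height: the number of `D`'s. -/
def height {a : ℕ} : {b : ℕ} → Walk a b → ℕ
  | _, nil => 0
  | _, stepUp w => w.height
  | _, stepDown w => w.height + 1

/-- A walk from level `k` to itself has as many `U`'s as `D`'s. -/
theorem add_ups_eq {a b : ℕ} (w : Walk a b) : a + w.ups = b + w.height := by
  induction w with
  | nil => rfl
  | stepUp w ih => simp only [ups, height]; omega
  | stepDown w ih => simp only [ups, height]; omega

/-- The operator `C_a → C_b` given by the word. -/
noncomputable def op {X : Type u} [Fintype X] [PartialOrder X] [GradeMinOrder ℕ X]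
    (wt : X → ℝ) {a : ℕ} : {b : ℕ} → Walk a b → (Cochain X a →ₗ[ℝ] Cochain X b)
  | _, nil => LinearMap.id
  | _, @stepUp _ b w => (up b).comp (w.op wt)
  | _, @stepDown _ b w => (down wt b).comp (w.op wt)

/-- `λ_{Y,δ,ℓ} = ∏_s (1 - δ^{m_s}_{m_s-ℓ})`, where `m_s` is the level on which the `s`-th `D` of the
word lands (`m_s = k - 2s + i_s` if it stands at position `i_s`) and
`δ^m_{m-ℓ} = ∏_{ℓ ≤ i ≤ m} δ_i`, which is `1` if `m < ℓ`. -/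
noncomputable def eig (δ : ℕ → ℝ) (l : ℕ) {a : ℕ} : {b : ℕ} → Walk a b → ℝ
  | _, nil => 1
  | _, stepUp w => w.eig δ l
  | _, @stepDown _ b w => w.eig δ l * (1 - ∏ i ∈ Finset.Icc l b, δ i)

/-- `∑_s γ^{m_s}_{m_s-ℓ} ∏_{t<s} (1 - δ^{m_t}_{m_t-ℓ})`, where
`γ^m_{m-ℓ} = γ ∑_{-1 ≤ i ≤ m-ℓ-1} δ^m_i = γ ∑_{ℓ+1 ≤ r ≤ m+1} ∏_{r ≤ i ≤ m} δ_i`. -/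
noncomputable def eigErr (δ : ℕ → ℝ) (γ : ℝ) (l : ℕ) {a : ℕ} : {b : ℕ} → Walk a b → ℝ
  | _, nil => 0
  | _, stepUp w => w.eigErr δ γ l
  | _, @stepDown _ b w => w.eigErr δ γ l +
      (γ * ∑ r ∈ Finset.Icc (l + 1) (b + 1), ∏ i ∈ Finset.Icc r b, δ i) * w.eig δ l

end Walk

/-- The operator `M = ∑_Y α_Y Y`. -/
noncomputable def combOp {X : Type u} [Fintype X] [PartialOrder X] [GradeMinOrder ℕ X]
    (wt : X → ℝ) {k : ℕ} (α : Walk k k →₀ ℝ) : Module.End ℝ (Cochain X k) :=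
  α.sum fun Y a => a • Y.op wt

/-- `M = ∑_Y α_Y Y` is an HD-walk: an affine combination of pure walks that stay within the levels
`0, …, d`, which is stochastic and self-adjoint. -/
structure IsHDWalk {X : Type u} [Fintype X] [PartialOrder X] [GradeMinOrder ℕ X]
    (d : ℕ) (wt : X → ℝ) {k : ℕ} (α : Walk k k →₀ ℝ) : Prop where
  top_le : ∀ Y ∈ α.support, Y.top ≤ d
  affine : (α.sum fun _ a => a) = 1
  nonneg : ∀ f : Cochain X k, (∀ x, 0 ≤ f x) → ∀ x, 0 ≤ combOp wt α f x
  map_one : combOp wt α (fun _ : Level X k => (1 : ℝ)) = fun _ => 1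
  selfAdjoint : ∀ f g : Cochain X k, ip wt (combOp wt α f) g = ip wt f (combOp wt α g)

/-- The height `h(M)`: the maximal height of a pure walk with non-zero coefficient. -/
def combHeight {k : ℕ} (α : Walk k k →₀ ℝ) : ℕ := α.support.sup Walk.height

/-- The weight `w(M) = |α|_1`. -/
noncomputable def combWeight {k : ℕ} (α : Walk k k →₀ ℝ) : ℝ := α.sum fun _ a => |a|

/-- The approximate eigenvalue `∑_Y α_Y λ_{Y,δ,ℓ}` of `M` on `V_k^ℓ`. -/
noncomputable def combEig (δ : ℕ → ℝ) (l : ℕ) {k : ℕ} (α : Walk k k →₀ ℝ) : ℝ :=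
  α.sum fun Y a => a * Y.eig δ l

end EPoset

open EPoset

/-!
The averaging operators `U_i` and `D_{i+1}` are contractions and adjoint to each other, and the
eposet condition allows a `D` to be moved past a `U`. Moving `D_{m+1}` through the whole of
`U^{m+1}_ℓ` gives
`D_{m+1} U^{m+1}_ℓ ≈ (1 - p) U^m_ℓ + p U^m_ℓ (U_{ℓ-1} D_ℓ)` with `p = ∏_{ℓ ≤ i ≤ m} δ_i`
(`IsEposet.nrm_down_upIter_sub_le`). On `H^ℓ = ker D_ℓ` the second term vanishes, and an induction
over the letters of a pure walk yields its approximate eigenvalues (`IsEposet.nrm_op_sub_le`).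

For an HD-walk the error has to be compared with `‖U^k_ℓ g‖` instead of `‖g‖`. By the approximate
commutation, `‖U^m_ℓ g‖²` for `g ∈ H^ℓ` satisfies an approximate linear recurrence in `m`. The same
recurrence holds for `‖U^m_ℓ 1_s‖²`, `s ∈ X(ℓ)`, because in a non-lazy poset all entries of
`U_{ℓ-1} D_ℓ`, and not only the diagonal ones, are at most `γ` (`IsNonLazy.lowerWalk_single_le`).
Counting chains, middle regularity shows that `U^k_ℓ 1_s` takes the value `1 / R(k,ℓ)` at all
`y ≥ s` (`upIter_single_apply`), so that `‖U^k_ℓ 1_s‖² = π(s) / R(k,ℓ)`. Hence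
`‖U^k_ℓ g‖² ≈ ‖g‖² / R(k,ℓ)` (`IsEposet.abs_nrm_upIter_sq_sub_le`).

The recurrence for `⟨U^m_ℓ g, U^m_{ℓ'} g'⟩` shows that the `V_k^ℓ` are approximately orthogonal
(`IsEposet.abs_ip_upIter_le`), hence independent; they span `C_k` since `C_{i+1}` is the orthogonal
sum of `ker D_{i+1}` and the image of `U_i`.

The spectrum is then located by linear algebra in a Euclidean space. In general an eigenvector is
split into its components in the `V_k^ℓ` (`exists_abs_sub_le_of_approx_orthogonal`). If the strips
are disjoint, then at least `dim V_k^ℓ` members of an orthonormal eigenbasis belong to the strip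
of `V_k^ℓ`, and these numbers add up to the dimension (`exists_abs_sub_le_of_disjoint`). In both
cases `V_k^0`, the space of constants, is split off: it is an exact eigenspace of eigenvalue `1`, and
it is orthogonal to the other `V_k^ℓ`.
-/

namespace EPoset

universe u

variable {X : Type u} [PartialOrder X] [GradeMinOrder ℕ X]

/-! ### Covering relations between consecutive levels -/

theorem covBy_iff_le {i : ℕ} (x : Level X i) (y : Level X (i + 1)) : x.1 ⋖ y.1 ↔ x.1 ≤ y.1 := by
  refine ⟨fun h => h.le, fun h => ?_⟩
  rw [covBy_iff_lt_covBy_grade (𝕆 := ℕ), x.2, y.2]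
  refine ⟨lt_of_le_of_ne h fun e => ?_, Order.covBy_add_one i⟩
  have := congrArg (grade ℕ) e
  rw [x.2, y.2] at this
  omega

theorem grade_of_covBy {i : ℕ} {x : X} {y : Level X (i + 1)} (h : x ⋖ y.1) : grade ℕ x = i := by
  have := h.grade ℕ
  rw [y.2, Order.covBy_iff_add_one_eq] at this
  omega

/-! ### Chains and indicator functions -/

theorem flagBetween_apply_le {i n : ℕ} {x y : X} (c : FlagBetween i n x y) (j : Fin (n + 1)) :
    c.1 j ≤ y :=
  (c.2.1.monotone (Fin.le_last j)).trans_eq c.2.2.2.1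

theorem flagBetween_sigma_ext {i n : ℕ} {x y : X}
    {p q : Σ z : {z : Level X (i + n) // z.1 ⋖ y}, FlagBetween i n x z.1.1}
    (h : p.2.1 = q.2.1) : p = q := by
  obtain ⟨z, c⟩ := p
  obtain ⟨z', c'⟩ := q
  have hz : z = z' := Subtype.ext (Subtype.ext
    (c.2.2.2.1.symm.trans ((congrFun h (Fin.last n)).trans c'.2.2.2.1)))
  subst hz
  exact congrArg (Sigma.mk z) (Subtype.ext h)

/-- Deleting its last element, a chain from `x` to `y` of length `n + 1` becomes an element `z`
covered by `y` together with a chain from `x` to `z`. -/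
def flagBetweenSuccEquiv (i n : ℕ) (x : X) (y : Level X (i + n + 1)) :
    FlagBetween i (n + 1) x y.1 ≃
      Σ z : {z : Level X (i + n) // z.1 ⋖ y.1}, FlagBetween i n x z.1.1 where
  toFun c := ⟨⟨⟨c.1 (Fin.last n).castSucc, by simpa using c.2.2.2.2 (Fin.last n).castSucc⟩,
      (covBy_iff_le _ _).2 (flagBetween_apply_le c _)⟩,
    ⟨fun j => c.1 j.castSucc, fun a b h => c.2.1 (Fin.castSucc_lt_castSucc_iff.2 h),
      c.2.2.1, rfl, fun j => by simpa using c.2.2.2.2 j.castSucc⟩⟩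
  invFun p := ⟨Fin.snoc (α := fun _ => X) p.2.1 y.1, by
      obtain ⟨c, h1, h2, h3, h4⟩ := p.2
      refine ⟨Fin.strictMono_iff_lt_succ.2 fun j => ?_, ?_, ?_, fun j => ?_⟩
      · induction j using Fin.lastCases with
        | last =>
          simp only [Fin.snoc_castSucc, Fin.succ_last, Fin.snoc_last, h3]
          exact p.1.2.lt
        | cast j =>
          rw [Fin.succ_castSucc]
          simp only [Fin.snoc_castSucc]
          exact h1 (Fin.castSucc_lt_succ)
      · exact (Fin.snoc_castSucc (α := fun _ => X) y.1 c 0).trans h2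
      · exact Fin.snoc_last (α := fun _ => X) _ _
      · induction j using Fin.lastCases with
        | last => simpa [← add_assoc] using y.2
        | cast j => simpa using h4 j⟩
  left_inv c := by
    refine Subtype.ext (funext fun j => ?_)
    induction j using Fin.lastCases with
    | last => simpa using c.2.2.2.1.symm
    | cast j => simp
  right_inv p := flagBetween_sigma_ext (funext fun j => by simp)

open Classical in
theorem card_flagBetween_zero {i : ℕ} (x y : Level X i) :
    Nat.card (FlagBetween i 0 x.1 y.1) = if x = y then 1 else 0 := by
  split_ifs with h
  · subst h
    have hsub : ∀ j : Fin (0 + 1), j = 0 := fun j => Fin.ext (by omega)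
    rw [Nat.card_eq_one_iff_unique]
    refine ⟨⟨fun a b => Subtype.ext (funext fun j => ?_)⟩, ⟨⟨fun _ => x.1,
      fun a b hab => absurd hab (by simp [hsub a, hsub b]), rfl, rfl, fun j => ?_⟩⟩⟩
    · rw [hsub j, a.2.2.1, b.2.2.1]
    · rw [hsub j]; exact x.2
  · have : IsEmpty (FlagBetween i 0 x.1 y.1) :=
      ⟨fun c => h (Subtype.ext (c.2.2.1.symm.trans c.2.2.2.1))⟩
    exact Nat.card_of_isEmpty

open Classical in
theorem single_one_nonneg {l : ℕ} (s y : Level X l) : 0 ≤ Pi.single (M := fun _ => ℝ) s 1 y := by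
  rw [Pi.single_apply]
  split_ifs <;> norm_num

/-! ### The regularity function and the weights -/

variable [Fintype X] {d : ℕ} {wt : X → ℝ} {δ : ℕ → ℝ} {γ : ℝ}

open Classical in
theorem IsRegularPoset.card_covBy (hX : IsRegularPoset X d) {i : ℕ} (hi : i < d)
    (y : Level X (i + 1)) :
    (Finset.univ.filter fun x : Level X i => x.1 ⋖ y.1).card = regularity X (i + 1) i := by
  obtain ⟨r, hr⟩ := hX.downward (i + 1) hi
  have key : ∀ z : Level X (i + 1),
      (Finset.univ.filter fun x : Level X i => x.1 ⋖ z.1).card = r := by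
    intro z
    rw [← hr z]
    refine Finset.card_bij (fun x _ => x.1) ?_ ?_ ?_
    · intro x hx; simpa using hx
    · intro x _ x' _ h; exact Subtype.ext h
    · intro x hx
      have hx' : x ⋖ z.1 := by simpa using hx
      exact ⟨⟨x, grade_of_covBy hx'⟩, by simpa using hx', rfl⟩
  rw [key]
  unfold regularity
  simp_rw [← covBy_iff_le, key]
  exact (Finset.sup_const ⟨y, Finset.mem_univ y⟩ r).symm

theorem IsMeasured.nonempty (hw : IsMeasured X d wt) {i : ℕ} (hi : i ≤ d) :
    Nonempty (Level X i) := by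
  by_contra h
  rw [not_nonempty_iff] at h
  simpa using hw.sum_eq_one i hi

theorem IsMeasured.regularity_pos (hw : IsMeasured X d wt) {i : ℕ} (hi : i < d) :
    (0 : ℝ) < regularity X (i + 1) i := by
  obtain ⟨x⟩ := hw.nonempty hi.le
  refine lt_of_le_of_ne (Nat.cast_nonneg _) fun h => ?_
  have := hw.induced i hi x
  rw [← h] at this
  simp only [inv_zero, zero_mul] at this
  exact (hw.pos x.1).ne' this

open Classical in
theorem IsMeasured.sum_covBy (hw : IsMeasured X d wt) {i : ℕ} (hi : i < d) (x : Level X i) :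
    ∑ y ∈ Finset.univ.filter (fun y : Level X (i + 1) => x.1 ⋖ y.1), wt y.1
      = regularity X (i + 1) i * wt x.1 := by
  rw [hw.induced i hi x, mul_inv_cancel_left₀ (hw.regularity_pos hi).ne']

/-! ### The weighted inner product -/

/-- The isometric embedding `f ↦ √π · f` of `C_i` into Euclidean space, through which the inner
product `ip` inherits the inequalities of an inner product space. -/
noncomputable def toEuclid (wt : X → ℝ) (i : ℕ) :
    Cochain X i →ₗ[ℝ] EuclideanSpace ℝ (Level X i) where
  toFun f := WithLp.toLp 2 fun x => √(wt x.1) * f x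
  map_add' f g := by ext x; simp [mul_add]
  map_smul' c f := by ext x; simp [mul_left_comm]

theorem IsMeasured.inner_toEuclid (hw : IsMeasured X d wt) {i : ℕ} (f g : Cochain X i) :
    inner ℝ (toEuclid wt i f) (toEuclid wt i g) = ip wt f g := by
  simp only [toEuclid, LinearMap.coe_mk, AddHom.coe_mk, PiLp.inner_apply, ip]
  refine Finset.sum_congr rfl fun x _ => ?_
  have := Real.mul_self_sqrt (hw.pos x.1).le
  simp only [RCLike.inner_apply, conj_trivial]
  linear_combination (f x * g x) * this

theorem IsMeasured.norm_toEuclid (hw : IsMeasured X d wt) {i : ℕ} (f : Cochain X i) :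
    ‖toEuclid wt i f‖ = nrm wt f := by
  rw [nrm, ← hw.inner_toEuclid, real_inner_self_eq_norm_sq, Real.sqrt_sq (norm_nonneg _)]

theorem IsMeasured.toEuclid_injective (hw : IsMeasured X d wt) (i : ℕ) :
    Function.Injective (toEuclid wt i) := by
  intro f g h
  funext x
  have := congrArg (fun v : EuclideanSpace ℝ (Level X i) => v x) h
  simpa [toEuclid, (Real.sqrt_pos.2 (hw.pos x.1)).ne'] using this

theorem ip_comm {i : ℕ} (f g : Cochain X i) : ip wt f g = ip wt g f :=
  Finset.sum_congr rfl fun x _ => by ring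

theorem nrm_nonneg {i : ℕ} (f : Cochain X i) : 0 ≤ nrm wt f := Real.sqrt_nonneg _

theorem IsMeasured.nrm_sq (hw : IsMeasured X d wt) {i : ℕ} (f : Cochain X i) :
    nrm wt f ^ 2 = ip wt f f := by
  rw [← hw.norm_toEuclid, ← hw.inner_toEuclid, real_inner_self_eq_norm_sq]

theorem IsMeasured.nrm_add_le (hw : IsMeasured X d wt) {i : ℕ} (f g : Cochain X i) :
    nrm wt (f + g) ≤ nrm wt f + nrm wt g := by
  simp only [← hw.norm_toEuclid, map_add]
  exact norm_add_le _ _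

theorem IsMeasured.nrm_smul (hw : IsMeasured X d wt) {i : ℕ} (c : ℝ) (f : Cochain X i) :
    nrm wt (c • f) = |c| * nrm wt f := by
  simp only [← hw.norm_toEuclid, map_smul, norm_smul, Real.norm_eq_abs]

theorem IsMeasured.abs_ip_le (hw : IsMeasured X d wt) {i : ℕ} (f g : Cochain X i) :
    |ip wt f g| ≤ nrm wt f * nrm wt g := by
  simp only [← hw.norm_toEuclid, ← hw.inner_toEuclid]
  exact abs_real_inner_le_norm _ _

theorem nrm_zero {i : ℕ} : nrm wt (0 : Cochain X i) = 0 := by simp [nrm, ip]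

theorem ip_add_left {i : ℕ} (f g h : Cochain X i) :
    ip wt (f + g) h = ip wt f h + ip wt g h := by
  simp only [ip, ← Finset.sum_add_distrib, Pi.add_apply]
  exact Finset.sum_congr rfl fun x _ => by ring

theorem ip_smul_left {i : ℕ} (c : ℝ) (f h : Cochain X i) :
    ip wt (c • f) h = c * ip wt f h := by
  simp only [ip, Finset.mul_sum, Pi.smul_apply, smul_eq_mul]
  exact Finset.sum_congr rfl fun x _ => by ring

/-! ### The averaging operators -/

/-- The constant function `1` on `X(i)`. -/
abbrev one (X : Type u) [PartialOrder X] [GradeMinOrder ℕ X] (i : ℕ) : Cochain X i := fun _ => 1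

theorem IsMeasured.ip_one_one (hw : IsMeasured X d wt) {i : ℕ} (hi : i ≤ d) :
    ip wt (one X i) (one X i) = 1 := by
  simpa [ip] using hw.sum_eq_one i hi

theorem ip_down_left (hw : IsMeasured X d wt) {i : ℕ} (hi : i < d)
    (f : Cochain X (i + 1)) (g : Cochain X i) :
    ip wt (down wt i f) g = ip wt f (up i g) := by
  classical
  have hR := (hw.regularity_pos hi).ne'
  have h1 : ∀ x : Level X i, wt x.1 * down wt i f x * g x =
      ∑ y : Level X (i + 1), if x.1 ⋖ y.1 then
        (regularity X (i + 1) i : ℝ)⁻¹ * (wt y.1 * f y * g x) else 0 := by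
    intro x
    rw [← Finset.sum_filter, ← Finset.mul_sum]
    have hx := (hw.pos x.1).ne'
    simp only [down, LinearMap.coe_mk, AddHom.coe_mk]
    rw [hw.sum_covBy hi, ← Finset.sum_mul]
    field_simp
  have h2 : ∀ y : Level X (i + 1), wt y.1 * f y * up i g y =
      ∑ x : Level X i, if x.1 ⋖ y.1 then
        (regularity X (i + 1) i : ℝ)⁻¹ * (wt y.1 * f y * g x) else 0 := by
    intro y
    rw [← Finset.sum_filter, ← Finset.mul_sum]
    simp only [up, LinearMap.coe_mk, AddHom.coe_mk, ← Finset.mul_sum]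
    ring
  simp only [ip, h1, h2]
  exact Finset.sum_comm

theorem up_one (hX : IsRegularPoset X d) (hw : IsMeasured X d wt) {i : ℕ} (hi : i < d) :
    up i (one X i) = one X (i + 1) := by
  classical
  funext y
  simp only [up, LinearMap.coe_mk, AddHom.coe_mk, one, Finset.sum_const, nsmul_eq_mul, mul_one]
  rw [← hX.card_covBy hi y]
  refine inv_mul_cancel₀ ?_
  rw [hX.card_covBy hi y]
  exact (hw.regularity_pos hi).ne'

theorem down_one (hw : IsMeasured X d wt) {i : ℕ} (hi : i < d) :
    down wt i (one X (i + 1)) = one X i := by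
  classical
  funext x
  simp only [down, LinearMap.coe_mk, AddHom.coe_mk, one, mul_one]
  exact inv_mul_cancel₀ (by
    rw [hw.sum_covBy hi]
    exact (mul_pos (hw.regularity_pos hi) (hw.pos _)).ne')

theorem up_nonneg {i : ℕ} {f : Cochain X i} (hf : ∀ x, 0 ≤ f x) (y : Level X (i + 1)) :
    0 ≤ up i f y :=
  mul_nonneg (by positivity) (Finset.sum_nonneg fun x _ => hf x)

theorem down_nonneg (hw : IsMeasured X d wt) {i : ℕ} {f : Cochain X (i + 1)}
    (hf : ∀ x, 0 ≤ f x) (y : Level X i) : 0 ≤ down wt i f y :=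
  mul_nonneg (inv_nonneg.2 (Finset.sum_nonneg fun _ _ => (hw.pos _).le))
    (Finset.sum_nonneg fun x _ => mul_nonneg (hw.pos _).le (hf x))

theorem nrm_up_le (hX : IsRegularPoset X d) (hw : IsMeasured X d wt) {i : ℕ} (hi : i < d)
    (f : Cochain X i) : nrm wt (up i f) ≤ nrm wt f := by
  classical
  have hR := hw.regularity_pos hi
  -- Cauchy-Schwarz: the square of an average is at most the average of the squares
  have hsq : ∀ y, up i f y ^ 2 ≤ up i (f ^ 2) y := by
    intro y
    have h := sq_sum_le_card_mul_sum_sq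
      (s := Finset.univ.filter (fun x : Level X i => x.1 ⋖ y.1)) (f := f)
    rw [hX.card_covBy hi] at h
    simp only [up, LinearMap.coe_mk, AddHom.coe_mk, mul_pow, Pi.pow_apply]
    calc _ ≤ (regularity X (i + 1) i : ℝ)⁻¹ ^ 2 * _ := mul_le_mul_of_nonneg_left h (by positivity)
      _ = _ := by field_simp
  refine Real.sqrt_le_sqrt ?_
  calc ip wt (up i f) (up i f) ≤ ip wt (one X (i + 1)) (up i (f ^ 2)) := by
        refine Finset.sum_le_sum fun y _ => ?_
        have := mul_le_mul_of_nonneg_left (hsq y) (hw.pos y.1).le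
        simp only [mul_one]
        linarith
    _ = ip wt f f := by
        rw [← ip_down_left hw hi, down_one hw hi]
        exact Finset.sum_congr rfl fun x _ => by simp only [Pi.pow_apply]; ring

theorem nrm_down_le (hX : IsRegularPoset X d) (hw : IsMeasured X d wt) {i : ℕ} (hi : i < d)
    (f : Cochain X (i + 1)) : nrm wt (down wt i f) ≤ nrm wt f := by
  rcases (nrm_nonneg (wt := wt) (down wt i f)).eq_or_lt with h | h
  · rw [← h]; exact nrm_nonneg _
  have h1 : nrm wt (down wt i f) ^ 2 ≤ nrm wt f * nrm wt (down wt i f) := by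
    rw [hw.nrm_sq, ip_down_left hw hi]
    exact (le_abs_self _).trans ((hw.abs_ip_le _ _).trans
      (mul_le_mul_of_nonneg_left (nrm_up_le hX hw hi _) (nrm_nonneg _)))
  rw [sq] at h1
  exact le_of_mul_le_mul_right h1 h

theorem cochain_zero_eq_smul_one (hX : IsRegularPoset X d) (f : Cochain X 0) (x₀ : Level X 0) :
    f = f x₀ • one X 0 := by
  obtain ⟨b, -, hb⟩ := hX.existsUnique_min
  have hmin : ∀ x : Level X 0, x.1 = b := fun x => hb _ fun y hy => by
    by_contra h
    have := grade_strictMono (𝕆 := ℕ) (lt_of_le_not_ge hy h)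
    rw [x.2] at this
    omega
  funext x
  rw [Subtype.ext ((hmin x).trans (hmin x₀).symm)]
  simp

/-- `D_1 U_0` is the identity, as `X(0)` is a single point. -/
theorem down_up_zero (hX : IsRegularPoset X d) (hw : IsMeasured X d wt) (hd : 0 < d)
    (f : Cochain X 0) : down wt 0 (up 0 f) = f := by
  obtain ⟨x₀⟩ := hw.nonempty (Nat.zero_le d)
  rw [cochain_zero_eq_smul_one hX f x₀, map_smul, map_smul, up_one hX hw hd, down_one hw hd]

theorem upIter_self {l : ℕ} (f : Cochain X l) : upIter le_rfl f = f := by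
  rw [upIter, Nat.leRec_self]
  rfl

theorem upIter_succ {l k : ℕ} (h : l ≤ k) (h' : l ≤ k + 1) (f : Cochain X l) :
    upIter h' f = up k (upIter h f) := by
  rw [upIter, Nat.leRec_succ _ _ h]
  rfl

theorem nrm_upIter_le (hX : IsRegularPoset X d) (hw : IsMeasured X d wt) {l k : ℕ} (h : l ≤ k)
    (hk : k ≤ d) (f : Cochain X l) : nrm wt (upIter h f) ≤ nrm wt f := by
  induction k, h using Nat.le_induction with
  | base => rw [upIter_self]
  | succ k h ih =>
    rw [upIter_succ h]
    exact (nrm_up_le hX hw hk _).trans (ih (by omega))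

theorem upIter_nonneg {l k : ℕ} (h : l ≤ k) {f : Cochain X l} (hf : ∀ x, 0 ≤ f x)
    (y : Level X k) : 0 ≤ upIter h f y := by
  induction k, h using Nat.le_induction with
  | base => rw [upIter_self]; exact hf y
  | succ k h ih =>
    rw [upIter_succ h]
    exact up_nonneg ih y

theorem upIter_one (hX : IsRegularPoset X d) (hw : IsMeasured X d wt) {l k : ℕ} (h : l ≤ k)
    (hk : k ≤ d) : upIter h (one X l) = one X k := by
  induction k, h using Nat.le_induction with
  | base => rw [upIter_self]
  | succ k h ih => rw [upIter_succ h, ih (by omega), up_one hX hw hk]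

/-- `⟨U^k_ℓ f, 1⟩ = ⟨f, 1⟩`. -/
theorem ip_upIter_one (hw : IsMeasured X d wt) {l k : ℕ} (h : l ≤ k) (hk : k ≤ d)
    (f : Cochain X l) : ip wt (upIter h f) (one X k) = ip wt f (one X l) := by
  induction k, h using Nat.le_induction with
  | base => rw [upIter_self]
  | succ k h ih =>
    rw [upIter_succ h, ip_comm, ← ip_down_left hw hk, down_one hw hk, ip_comm, ih (by omega)]

/-! ### Approximate commutation of the averaging operators -/

/-- The lower walk `U_{ℓ-1} D_ℓ` on `C_ℓ`, read as `0` on `C_0`; in the approximate commutation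
relation its coefficient for `ℓ = 0` is `0`, as `δ_0 = 0`. -/
noncomputable def lowerWalk (wt : X → ℝ) : (l : ℕ) → Cochain X l →ₗ[ℝ] Cochain X l
  | 0 => 0
  | l + 1 => (up l).comp (down wt l)

theorem lowerWalk_eq_zero {l : ℕ} {g : Cochain X l} (hg : g ∈ kerSpace wt l) :
    lowerWalk wt l g = 0 := by
  cases l with
  | zero => rfl
  | succ l =>
    have : down wt l g = 0 := hg
    rw [lowerWalk, LinearMap.comp_apply, this, map_zero]

/-- The error `γ ∑_{ℓ < r ≤ m+1} ∏_{r ≤ i ≤ m} δ_i` made when `D_{m+1}` is applied to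
`U^{m+1}_ℓ g`. -/
noncomputable def stepErr (δ : ℕ → ℝ) (γ : ℝ) (l m : ℕ) : ℝ :=
  γ * ∑ r ∈ Finset.Icc (l + 1) (m + 1), ∏ i ∈ Finset.Icc r m, δ i

theorem stepErr_self (δ : ℕ → ℝ) (γ : ℝ) (l : ℕ) : stepErr δ γ l l = γ := by
  simp [stepErr]

theorem stepErr_succ (δ : ℕ → ℝ) (γ : ℝ) {l m : ℕ} (h : l ≤ m) :
    stepErr δ γ l (m + 1) = γ + δ (m + 1) * stepErr δ γ l m := by
  have h1 : ∀ r ∈ Finset.Icc (l + 1) (m + 1),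
      ∏ i ∈ Finset.Icc r (m + 1), δ i = δ (m + 1) * ∏ i ∈ Finset.Icc r m, δ i := by
    intro r hr
    rw [Finset.prod_Icc_succ_top (Finset.mem_Icc.1 hr).2, mul_comm]
  rw [stepErr, Finset.sum_Icc_succ_top (by omega), Finset.sum_congr rfl h1, ← Finset.mul_sum,
    Finset.Icc_eq_empty (by omega : ¬ m + 1 + 1 ≤ m + 1), Finset.prod_empty, stepErr]
  ring

theorem IsEposet.mem_Icc (hE : IsEposet X d wt δ γ) {i : ℕ} (hi : i < d) :
    δ i ∈ Set.Icc (0 : ℝ) 1 := by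
  rcases Nat.eq_zero_or_pos i with rfl | h
  · simp [hE.delta_zero]
  · exact hE.delta_mem i h hi

theorem IsEposet.prod_mem_Icc (hE : IsEposet X d wt δ γ) {l m : ℕ} (hm : m < d) :
    ∏ i ∈ Finset.Icc l m, δ i ∈ Set.Icc (0 : ℝ) 1 := by
  have h : ∀ i ∈ Finset.Icc l m, δ i ∈ Set.Icc (0 : ℝ) 1 := fun i hi =>
    hE.mem_Icc (lt_of_le_of_lt (Finset.mem_Icc.1 hi).2 hm)
  exact ⟨Finset.prod_nonneg fun i hi => (h i hi).1,
    Finset.prod_le_one (fun i hi => (h i hi).1) fun i hi => (h i hi).2⟩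

theorem IsEposet.stepErr_nonneg (hE : IsEposet X d wt δ γ) {l m : ℕ} (hm : m < d) :
    0 ≤ stepErr δ γ l m :=
  mul_nonneg hE.gamma_nonneg (Finset.sum_nonneg fun _ _ => (hE.prod_mem_Icc hm).1)

theorem IsEposet.stepErr_le (hE : IsEposet X d wt δ γ) {l m : ℕ} (hm : m < d) :
    stepErr δ γ l m ≤ γ * (m + 1) := by
  refine mul_le_mul_of_nonneg_left ?_ hE.gamma_nonneg
  calc _ ≤ ∑ r ∈ Finset.Icc (l + 1) (m + 1), (1 : ℝ) :=
        Finset.sum_le_sum fun _ _ => (hE.prod_mem_Icc hm).2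
    _ ≤ m + 1 := by
        rw [Finset.sum_const, Nat.card_Icc, nsmul_eq_mul, mul_one]
        exact_mod_cast (by omega : m + 1 + 1 - (l + 1) ≤ m + 1)

/-- `D_{m+1} U^{m+1}_ℓ ≈ (1 - p) U^m_ℓ + p U^m_ℓ (U_{ℓ-1} D_ℓ)` with `p = ∏_{ℓ ≤ i ≤ m} δ_i`: the
operator `D` is moved past the `U`'s one at a time. -/
theorem IsEposet.nrm_down_upIter_sub_le (hX : IsRegularPoset X d) (hw : IsMeasured X d wt)
    (hE : IsEposet X d wt δ γ) {l m : ℕ} (h : l ≤ m) (hm : m < d) (f : Cochain X l) :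
    nrm wt (down wt m (up m (upIter h f)) - ((1 - ∏ i ∈ Finset.Icc l m, δ i) • upIter h f
      + (∏ i ∈ Finset.Icc l m, δ i) • upIter h (lowerWalk wt l f)))
      ≤ stepErr δ γ l m * nrm wt f := by
  induction m, h using Nat.le_induction with
  | base =>
    simp only [upIter_self, Finset.Icc_self, Finset.prod_singleton, stepErr_self]
    cases l with
    | zero =>
      rw [down_up_zero hX hw hm, hE.delta_zero]
      simp only [sub_zero, one_smul, zero_smul, add_zero, sub_self, nrm_zero]
      exact mul_nonneg hE.gamma_nonneg (nrm_nonneg _)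
    | succ l =>
      have := hE.expanding l hm f
      rwa [sub_sub] at this
  | succ m h ih =>
    have ih := ih (by omega)
    rw [Finset.prod_Icc_succ_top (by omega), stepErr_succ _ _ h, upIter_succ h, upIter_succ h]
    set p := ∏ i ∈ Finset.Icc l m, δ i
    set F := upIter h f
    set Q := upIter h (lowerWalk wt l f)
    have hδ := hE.mem_Icc hm
    have e1 := hE.expanding m hm (up m F)
    have hF : nrm wt (up m F) ≤ nrm wt f := by
      rw [← upIter_succ h (by omega) f]
      exact nrm_upIter_le hX hw _ hm.le f
    have key : down wt (m + 1) (up (m + 1) (up m F)) - ((1 - p * δ (m + 1)) • up m F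
          + (p * δ (m + 1)) • up m Q)
        = (down wt (m + 1) (up (m + 1) (up m F)) - (1 - δ (m + 1)) • up m F
            - δ (m + 1) • up m (down wt m (up m F)))
          + δ (m + 1) • up m (down wt m (up m F) - ((1 - p) • F + p • Q)) := by
      simp only [map_sub, map_add, map_smul]
      module
    rw [key]
    refine (hw.nrm_add_le _ _).trans ?_
    rw [hw.nrm_smul, abs_of_nonneg hδ.1, add_mul, mul_assoc]
    exact add_le_add (e1.trans (mul_le_mul_of_nonneg_left hF hE.gamma_nonneg))
      (mul_le_mul_of_nonneg_left ((nrm_up_le hX hw (by omega) _).trans ih) hδ.1)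

theorem IsEposet.nrm_down_upIter_ker_sub_le (hX : IsRegularPoset X d) (hw : IsMeasured X d wt)
    (hE : IsEposet X d wt δ γ) {l m : ℕ} (h : l ≤ m) (hm : m < d) {g : Cochain X l}
    (hg : g ∈ kerSpace wt l) :
    nrm wt (down wt m (up m (upIter h g)) - (1 - ∏ i ∈ Finset.Icc l m, δ i) • upIter h g)
      ≤ stepErr δ γ l m * nrm wt g := by
  have := hE.nrm_down_upIter_sub_le hX hw h hm g
  rwa [lowerWalk_eq_zero hg, map_zero, smul_zero, add_zero] at this

/-! ### Pure walks -/

theorem Walk.le_top {a b : ℕ} (w : Walk a b) : b ≤ w.top := by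
  induction w with
  | nil => exact le_rfl
  | stepUp w ih => exact le_max_right _ _
  | stepDown w ih => exact (Nat.le_succ _).trans ih

theorem IsEposet.eig_mem_Icc (hE : IsEposet X d wt δ γ) {a b : ℕ} (w : Walk a b)
    (hd : w.top ≤ d) (l : ℕ) : w.eig δ l ∈ Set.Icc (0 : ℝ) 1 := by
  induction w with
  | nil => simp [Walk.eig]
  | stepUp w ih => exact ih ((le_max_left _ _).trans hd)
  | @stepDown b w ih =>
    have ih := ih hd
    have hb : b < d := w.le_top.trans hd
    have hp := hE.prod_mem_Icc (l := l) hb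
    exact ⟨mul_nonneg ih.1 (by linarith [hp.2]),
      mul_le_one₀ ih.2 (by linarith [hp.2]) (by linarith [hp.1])⟩

theorem IsEposet.eigErr_le (hE : IsEposet X d wt δ γ) {a b : ℕ} (w : Walk a b)
    (hd : w.top ≤ d) (l : ℕ) : w.eigErr δ γ l ≤ γ * (a + w.ups) * w.height := by
  have hγ := hE.gamma_nonneg
  induction w with
  | nil => simp [Walk.eigErr, Walk.height]
  | stepUp w ih =>
    have ih := ih ((le_max_left _ _).trans hd)
    simp only [Walk.eigErr, Walk.ups, Walk.height]
    push_cast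
    have : 0 ≤ γ * w.height := by positivity
    linarith
  | @stepDown b w ih =>
    have ih := ih hd
    have hb : b < d := w.le_top.trans hd
    have hw : (b : ℝ) + 1 ≤ a + w.ups := by
      have := w.add_ups_eq
      exact_mod_cast (by omega : b + 1 ≤ a + w.ups)
    simp only [Walk.eigErr, Walk.ups, Walk.height]
    push_cast
    have h1 : stepErr δ γ l b * w.eig δ l ≤ γ * (a + w.ups) * 1 :=
      mul_le_mul ((hE.stepErr_le hb).trans (mul_le_mul_of_nonneg_left hw hγ))
        (hE.eig_mem_Icc w hd l).2 (hE.eig_mem_Icc w hd l).1 (by positivity)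
    unfold stepErr at h1
    linarith

/-- Along the word, the image of `U^a_ℓ g` stays close to a multiple of `U^b_ℓ g`, until the word
descends below level `ℓ`; from then on it is close to `0`, and so is its approximate eigenvalue. -/
theorem IsEposet.nrm_op_sub_le (hX : IsRegularPoset X d) (hw : IsMeasured X d wt)
    (hE : IsEposet X d wt δ γ) {a b : ℕ} (w : Walk a b) (hd : w.top ≤ d) {l : ℕ} (ha : l ≤ a)
    {g : Cochain X l} (hg : g ∈ kerSpace wt l) :
    (∀ hb : l ≤ b, nrm wt (w.op wt (upIter ha g) - w.eig δ l • upIter hb g)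
        ≤ nrm wt g * w.eigErr δ γ l) ∧
      (b < l → w.eig δ l = 0) ∧
      (w.eig δ l = 0 → nrm wt (w.op wt (upIter ha g)) ≤ nrm wt g * w.eigErr δ γ l) := by
  induction w with
  | nil =>
    refine ⟨fun _ => ?_, fun h => absurd ha (by omega), fun h => ?_⟩
    · simp [Walk.op, Walk.eig, Walk.eigErr, nrm_zero]
    · simp [Walk.eig] at h
  | @stepUp b w ih =>
    obtain ⟨h1, h2, h3⟩ := ih ((le_max_left _ _).trans hd)
    have hb : b < d := lt_of_lt_of_le (Nat.lt_succ_self b) ((le_max_right w.top (b + 1)).trans hd)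
    have h3' : w.eig δ l = 0 →
        nrm wt (up b (w.op wt (upIter ha g))) ≤ nrm wt g * w.eigErr δ γ l := fun h =>
      (nrm_up_le hX hw hb _).trans (h3 h)
    refine ⟨fun hl => ?_, fun h => h2 (by omega), h3'⟩
    simp only [Walk.op, Walk.eig, Walk.eigErr, LinearMap.comp_apply]
    rcases Nat.lt_or_ge b l with hbl | hbl
    · rw [h2 hbl, zero_smul, sub_zero]
      exact h3' (h2 hbl)
    · rw [upIter_succ hbl, ← map_smul, ← map_sub]
      exact (nrm_up_le hX hw hb _).trans (h1 hbl)
  | @stepDown b w ih =>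
    obtain ⟨h1, h2, h3⟩ := ih hd
    have hb : b < d := w.le_top.trans hd
    have he := hE.eig_mem_Icc w hd l
    have hs := mul_nonneg (hE.stepErr_nonneg (l := l) hb) he.1
    have h3' : w.eig δ l = 0 → nrm wt (down wt b (w.op wt (upIter ha g)))
        ≤ nrm wt g * (w.eigErr δ γ l + stepErr δ γ l b * w.eig δ l) := fun h =>
      (nrm_down_le hX hw hb _).trans ((h3 h).trans
        (mul_le_mul_of_nonneg_left (le_add_of_nonneg_right hs) (nrm_nonneg _)))
    have hmain : ∀ hl : l ≤ b, nrm wt (down wt b (w.op wt (upIter ha g))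
        - (w.eig δ l * (1 - ∏ i ∈ Finset.Icc l b, δ i)) • upIter hl g)
        ≤ nrm wt g * (w.eigErr δ γ l + stepErr δ γ l b * w.eig δ l) := by
      intro hl
      have key : down wt b (w.op wt (upIter ha g))
            - (w.eig δ l * (1 - ∏ i ∈ Finset.Icc l b, δ i)) • upIter hl g
          = down wt b (w.op wt (upIter ha g) - w.eig δ l • up b (upIter hl g))
            + w.eig δ l • (down wt b (up b (upIter hl g))
              - (1 - ∏ i ∈ Finset.Icc l b, δ i) • upIter hl g) := by
        simp only [map_sub, map_smul]
        module
      have h1 := h1 (by omega)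
      rw [upIter_succ hl] at h1
      rw [key]
      refine (hw.nrm_add_le _ _).trans ?_
      rw [hw.nrm_smul, abs_of_nonneg he.1]
      have h4 := mul_le_mul_of_nonneg_left (hE.nrm_down_upIter_ker_sub_le hX hw hl hb hg) he.1
      have h5 := nrm_down_le hX hw hb (w.op wt (upIter ha g) - w.eig δ l • up b (upIter hl g))
      linarith
    refine ⟨hmain, fun h => ?_, fun h => ?_⟩
    · simp [Walk.eig, Finset.Icc_eq_empty (by omega : ¬ l ≤ b)]
    · simp only [Walk.op, Walk.eigErr, LinearMap.comp_apply]
      rcases Nat.lt_or_ge b l with hbl | hbl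
      · rcases (by omega : b + 1 = l ∨ b + 1 < l) with rfl | hbl
        · -- the first step below level `ℓ` kills the main term, as `g` is in the kernel of `D_ℓ`
          have hg' : down wt b g = 0 := hg
          have h1 := (nrm_down_le hX hw hb _).trans (h1 le_rfl)
          rw [map_sub, map_smul, upIter_self, hg', smul_zero, sub_zero] at h1
          exact h1.trans (mul_le_mul_of_nonneg_left (le_add_of_nonneg_right hs) (nrm_nonneg _))
        · exact h3' (h2 hbl)
      · have := hmain hbl
        simp only [Walk.eig] at h
        rwa [h, zero_smul, sub_zero] at this

/-! ### The values of `U^k_ℓ 1_s` -/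

theorem finite_flagBetween (i n : ℕ) (x y : X) : Finite (FlagBetween i n x y) := by
  unfold FlagBetween
  infer_instance

open Classical in
theorem card_flagBetween_succ (i n : ℕ) (x : X) (y : Level X (i + n + 1)) :
    Nat.card (FlagBetween i (n + 1) x y.1) =
      ∑ z ∈ Finset.univ.filter (fun z : Level X (i + n) => z.1 ⋖ y.1),
        Nat.card (FlagBetween i n x z.1) := by
  have := fun z : {z : Level X (i + n) // z.1 ⋖ y.1} => finite_flagBetween i n x z.1.1
  rw [Nat.card_congr (flagBetweenSuccEquiv i n x y), Nat.card_sigma]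
  exact (Finset.sum_subtype _ (by simp)
    (fun z : Level X (i + n) => Nat.card (FlagBetween i n x z.1))).symm

open Classical in
/-- `U^{i+n}_i 1_s` counts chains that start at `s`. -/
theorem upIter_single_eq_card (i n : ℕ) (s : Level X i) (y : Level X (i + n)) :
    upIter (Nat.le_add_right i n) (Pi.single s (1 : ℝ)) y =
      (∏ j ∈ Finset.range n, (regularity X (i + j + 1) (i + j) : ℝ)⁻¹) *
        Nat.card (FlagBetween i n s.1 y.1) := by
  induction n with
  | zero =>
    rw [card_flagBetween_zero]
    simp only [upIter_self, Pi.single_apply, Finset.range_zero, Finset.prod_empty,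
      one_mul, eq_comm (a := s)]
    split_ifs <;> simp
  | succ n ih =>
    have h := upIter_succ (Nat.le_add_right i n) (Nat.le_add_right i (n + 1))
      (Pi.single s (1 : ℝ))
    rw [h, card_flagBetween_succ, Finset.prod_range_succ]
    simp only [up, LinearMap.coe_mk, AddHom.coe_mk, ih, ← Finset.mul_sum]
    push_cast
    ring

open Classical in
theorem exists_upIter_single_eq (hX : IsRegularPoset X d) {l k : ℕ} (h : l ≤ k) (hk : k ≤ d) :
    ∃ v : ℝ, ∀ (s : Level X l) (y : Level X k),
      upIter h (Pi.single s (1 : ℝ)) y = if s.1 ≤ y.1 then v else 0 := by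
  obtain ⟨n, rfl⟩ := Nat.exists_eq_add_of_le h
  rcases Nat.eq_zero_or_pos n with rfl | hn
  · refine ⟨1, fun s y => ?_⟩
    rw [upIter_single_eq_card, card_flagBetween_zero]
    have : s = y ↔ s.1 ≤ y.1 := by
      refine ⟨fun e => e ▸ le_rfl, fun hle => Subtype.ext ?_⟩
      by_contra hne
      have := grade_strictMono (𝕆 := ℕ) (lt_of_le_of_ne hle hne)
      rw [s.2, y.2] at this
      omega
    simp [this]
  · obtain ⟨m, hm⟩ := hX.middle l n hk
    refine ⟨(∏ j ∈ Finset.range n, (regularity X (l + j + 1) (l + j) : ℝ)⁻¹) * m, fun s y => ?_⟩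
    rw [upIter_single_eq_card]
    split_ifs with hle
    · rw [hm s y (lt_of_le_of_ne hle fun e => ?_)]
      have := congrArg (grade ℕ) e
      rw [s.2, y.2] at this
      omega
    · have : IsEmpty (FlagBetween l n s.1 y.1) :=
        ⟨fun c => hle (c.2.2.1.symm.le.trans (flagBetween_apply_le c 0))⟩
      rw [Nat.card_of_isEmpty]
      simp

open Classical in
theorem upIter_single_apply (hX : IsRegularPoset X d) (hw : IsMeasured X d wt) {l k : ℕ}
    (h : l ≤ k) (hk : k ≤ d) (s : Level X l) (y : Level X k) :
    upIter h (Pi.single s (1 : ℝ)) y = if s.1 ≤ y.1 then (regularity X k l : ℝ)⁻¹ else 0 := by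
  obtain ⟨v, hv⟩ := exists_upIter_single_eq hX h hk
  -- the values sum up to `1`, which determines their common value `v`
  have hcard : ∀ y : Level X k,
      ((Finset.univ.filter fun x : Level X l => x.1 ≤ y.1).card : ℝ) * v = 1 := by
    intro y
    have h1 : upIter h (one X l) y = 1 := by rw [upIter_one hX hw h hk]
    have h2 : one X l = ∑ s : Level X l, Pi.single s (1 : ℝ) :=
      (Finset.univ_sum_single (one X l)).symm
    rw [h2, map_sum, Finset.sum_apply] at h1
    simp only [hv] at h1
    rw [← Finset.sum_filter, Finset.sum_const, nsmul_eq_mul] at h1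
    exact h1
  have hR : (Finset.univ.filter fun x : Level X l => x.1 ≤ y.1).card = regularity X k l := by
    have hc : ∀ z : Level X k, (Finset.univ.filter fun x : Level X l => x.1 ≤ z.1).card =
        (Finset.univ.filter fun x : Level X l => x.1 ≤ y.1).card := by
      intro z
      have hv0 : v ≠ 0 := by rintro rfl; simpa using hcard y
      exact_mod_cast mul_right_cancel₀ hv0 ((hcard z).trans (hcard y).symm)
    unfold regularity
    simp_rw [hc]
    exact (Finset.sup_const ⟨y, Finset.mem_univ y⟩ _).symm
  have := hcard y
  rw [hR] at this
  rw [hv, eq_inv_of_mul_eq_one_right this]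

theorem one_le_regularity (hX : IsRegularPoset X d) (hw : IsMeasured X d wt) {l k : ℕ}
    (h : l ≤ k) (hk : k ≤ d) : (1 : ℝ) ≤ regularity X k l := by
  classical
  have : regularity X k l ≠ 0 := by
    intro h0
    obtain ⟨y⟩ := hw.nonempty hk
    have h1 : upIter h (one X l) y = 1 := by rw [upIter_one hX hw h hk]
    have h2 : one X l = ∑ s : Level X l, Pi.single s (1 : ℝ) :=
      (Finset.univ_sum_single (one X l)).symm
    rw [h2, map_sum, Finset.sum_apply] at h1
    simp [upIter_single_apply hX hw h hk, h0] at h1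
  exact_mod_cast Nat.one_le_iff_ne_zero.2 this

theorem regularity_le_max {l k : ℕ} (h : l ≤ k) :
    (regularity X k l : ℝ) ≤ regularityMax X k := by
  exact_mod_cast Finset.le_sup (f := fun i => regularity X k i)
    (Finset.mem_range.2 (Nat.lt_succ_of_le h))

open Classical in
theorem ip_single_one {l : ℕ} (s : Level X l) :
    ip wt (Pi.single s (1 : ℝ)) (one X l) = wt s.1 := by
  simp [ip, Pi.single_apply]

open Classical in
theorem ip_single_self {l : ℕ} (s : Level X l) :
    ip wt (Pi.single s (1 : ℝ)) (Pi.single s (1 : ℝ)) = wt s.1 := by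
  simp [ip, Pi.single_apply]

open Classical in
theorem ip_upIter_single (hX : IsRegularPoset X d) (hw : IsMeasured X d wt) {l k : ℕ}
    (h : l ≤ k) (hk : k ≤ d) (s : Level X l) :
    ip wt (upIter h (Pi.single s (1 : ℝ))) (upIter h (Pi.single s (1 : ℝ)))
      = (regularity X k l : ℝ)⁻¹ * wt s.1 := by
  have h1 : ip wt (upIter h (Pi.single s (1 : ℝ))) (one X k) = wt s.1 := by
    rw [ip_upIter_one hw h hk, ip_single_one]
  rw [← h1, ip, ip, Finset.mul_sum]
  refine Finset.sum_congr rfl fun y _ => ?_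
  rw [upIter_single_apply hX hw h hk]
  split_ifs <;> ring

/-! ### Non-laziness and the norm of `U^k_ℓ` -/

open Classical in
/-- The entry of the lower walk at `(x, s)` is at most its diagonal entry at `s`: the former is a
sum over the `t` covered by both `x` and `s`, the latter over all `t` covered by `s`. -/
theorem IsNonLazy.lowerWalk_single_le (hw : IsMeasured X d wt) (hγ : 0 ≤ γ)
    (hN : IsNonLazy X d wt γ) {l : ℕ} (hl : l ≤ d) (s x : Level X l) :
    lowerWalk wt l (Pi.single s (1 : ℝ)) x ≤ γ := by
  cases l with
  | zero => exact hγ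
  | succ l =>
    refine le_trans ?_ (hN l hl s)
    simp only [lowerWalk, LinearMap.comp_apply]
    have h0 : ∀ t : Level X l, 0 ≤ down wt l (Pi.single s (1 : ℝ)) t :=
      down_nonneg hw (single_one_nonneg s)
    refine mul_le_mul_of_nonneg_left ?_ (by positivity)
    refine (Finset.sum_le_sum_of_subset_of_nonneg (Finset.subset_univ _)
      fun t _ _ => h0 t).trans_eq (Finset.sum_subset (Finset.subset_univ _) fun t _ hts => ?_).symm
    simp only [Finset.mem_filter, Finset.mem_univ, true_and] at hts
    simp only [down, LinearMap.coe_mk, AddHom.coe_mk]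
    refine mul_eq_zero_of_right _ (Finset.sum_eq_zero fun y hy => ?_)
    have : y ≠ s := by
      rintro rfl
      exact hts (Finset.mem_filter.1 hy).2
    rw [Pi.single_eq_of_ne this, mul_zero]

open Classical in
theorem lowerWalk_single_nonneg (hw : IsMeasured X d wt) {l : ℕ} (s x : Level X l) :
    0 ≤ lowerWalk wt l (Pi.single s (1 : ℝ)) x := by
  cases l with
  | zero => exact le_rfl
  | succ l => exact up_nonneg (down_nonneg hw (single_one_nonneg s)) x

open Classical in
theorem IsNonLazy.ip_upIter_lowerWalk_single_mem (hX : IsRegularPoset X d)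
    (hw : IsMeasured X d wt) (hγ : 0 ≤ γ) (hN : IsNonLazy X d wt γ) {l m : ℕ} (h : l ≤ m)
    (hm : m ≤ d) (s : Level X l) :
    ip wt (upIter h (lowerWalk wt l (Pi.single s (1 : ℝ)))) (upIter h (Pi.single s (1 : ℝ)))
      ∈ Set.Icc 0 (γ * wt s.1) := by
  have hs : ∀ y, 0 ≤ upIter h (Pi.single s (1 : ℝ)) y :=
    upIter_nonneg h (single_one_nonneg s)
  constructor
  · exact Finset.sum_nonneg fun y _ => mul_nonneg (mul_nonneg (hw.pos _).le
      (upIter_nonneg h (lowerWalk_single_nonneg hw s) y)) (hs y)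
  · have h1 : ∀ y, upIter h (lowerWalk wt l (Pi.single s (1 : ℝ))) y ≤ γ := by
      intro y
      have := upIter_nonneg h (f := γ • one X l - lowerWalk wt l (Pi.single s (1 : ℝ)))
        (fun x => by
          have := hN.lowerWalk_single_le hw hγ (h.trans hm) s x
          simpa using this) y
      rw [map_sub, map_smul, upIter_one hX hw h hm] at this
      simpa using this
    rw [← ip_single_one (wt := wt) s, ← ip_upIter_one hw h hm, ip, ip, Finset.mul_sum]
    refine Finset.sum_le_sum fun y _ => ?_
    have := mul_le_mul_of_nonneg_left (h1 y) (mul_nonneg (hw.pos y.1).le (hs y))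
    linarith

/-- How `⟨U^m_ℓ f, U^m_{ℓ'} f'⟩` evolves with `m`. -/
theorem IsEposet.abs_ip_upIter_succ_sub_le (hX : IsRegularPoset X d) (hw : IsMeasured X d wt)
    (hE : IsEposet X d wt δ γ) {l l' m : ℕ} (h : l ≤ m) (h' : l' ≤ m) (hm : m < d)
    (f : Cochain X l) (f' : Cochain X l') :
    |ip wt (upIter (Nat.le_succ_of_le h) f) (upIter (Nat.le_succ_of_le h') f')
      - ((1 - ∏ i ∈ Finset.Icc l m, δ i) * ip wt (upIter h f) (upIter h' f')
        + (∏ i ∈ Finset.Icc l m, δ i) * ip wt (upIter h (lowerWalk wt l f)) (upIter h' f'))|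
      ≤ γ * (m + 1) * (nrm wt f * nrm wt f') := by
  set p := ∏ i ∈ Finset.Icc l m, δ i with hp
  have key : ip wt (upIter (Nat.le_succ_of_le h) f) (upIter (Nat.le_succ_of_le h') f')
      - ((1 - p) * ip wt (upIter h f) (upIter h' f')
        + p * ip wt (upIter h (lowerWalk wt l f)) (upIter h' f'))
      = ip wt (down wt m (up m (upIter h f)) - ((1 - p) • upIter h f
        + p • upIter h (lowerWalk wt l f))) (upIter h' f') := by
    rw [sub_eq_add_neg (down wt m _), ← neg_one_smul ℝ ((1 - p) • upIter h f + _)]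
    simp only [ip_add_left, ip_smul_left]
    rw [ip_down_left hw hm, upIter_succ h, upIter_succ h']
    ring
  rw [key]
  refine (hw.abs_ip_le _ _).trans ?_
  rw [← mul_assoc]
  exact mul_le_mul ((hE.nrm_down_upIter_sub_le hX hw h hm f).trans
    (mul_le_mul_of_nonneg_right (hE.stepErr_le hm) (nrm_nonneg _)))
    (nrm_upIter_le hX hw h' hm.le f') (nrm_nonneg _)
    (mul_nonneg (mul_nonneg hE.gamma_nonneg (by positivity)) (nrm_nonneg _))

/-- The spaces `V_k^ℓ` are approximately orthogonal. -/
theorem IsEposet.abs_ip_upIter_le (hX : IsRegularPoset X d) (hw : IsMeasured X d wt)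
    (hE : IsEposet X d wt δ γ) {l l' k : ℕ} (hl : l' < l) (h : l ≤ k) (hk : k ≤ d)
    {g : Cochain X l} (hg : g ∈ kerSpace wt l) (g' : Cochain X l') :
    |ip wt (upIter h g) (upIter (hl.le.trans h) g')| ≤ γ * k ^ 2 * (nrm wt g * nrm wt g') := by
  have hγ := hE.gamma_nonneg
  have hgg : 0 ≤ nrm wt g * nrm wt g' := mul_nonneg (nrm_nonneg _) (nrm_nonneg _)
  induction k, h using Nat.le_induction with
  | base =>
    obtain ⟨l, rfl⟩ : ∃ n, l = n + 1 := ⟨l - 1, by omega⟩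
    have hg' : down wt l g = 0 := hg
    rw [upIter_self, upIter_succ (Nat.le_of_lt_succ hl), ← ip_down_left hw hk, hg']
    simp only [ip, Pi.zero_apply, mul_zero, zero_mul, Finset.sum_const_zero, abs_zero]
    positivity
  | succ m h ih =>
    have ih := ih (by omega)
    have h1 := hE.abs_ip_upIter_succ_sub_le hX hw h (hl.le.trans h) hk g g'
    rw [lowerWalk_eq_zero hg, map_zero] at h1
    have h0 : ip wt (0 : Cochain X m) (upIter (hl.le.trans h) g') = 0 := by simp [ip]
    rw [h0, mul_zero, add_zero] at h1
    have hp := hE.prod_mem_Icc (l := l) hk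
    set A := ip wt (upIter h g) (upIter (hl.le.trans h) g')
    have h2 : |(1 - ∏ i ∈ Finset.Icc l m, δ i) * A| ≤ |A| := by
      rw [abs_mul, abs_of_nonneg (by linarith [hp.2])]
      exact mul_le_of_le_one_left (abs_nonneg _) (by linarith [hp.1])
    have h3 := abs_sub_abs_le_abs_sub
      (ip wt (upIter (Nat.le_succ_of_le h) g) (upIter (Nat.le_succ_of_le (hl.le.trans h)) g'))
      ((1 - ∏ i ∈ Finset.Icc l m, δ i) * A)
    refine le_trans (by linarith :
      _ ≤ γ * m ^ 2 * (nrm wt g * nrm wt g') + γ * (m + 1) * (nrm wt g * nrm wt g')) ?_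
    push_cast
    rw [← add_mul, ← mul_add]
    exact mul_le_mul_of_nonneg_right (mul_le_mul_of_nonneg_left
      (by nlinarith [(Nat.cast_nonneg m : (0 : ℝ) ≤ m)]) hγ) hgg

/-- `‖U^k_ℓ g‖²` and `‖U^k_ℓ 1_s‖² = π(s) / R(k,ℓ)` obey the same approximate recurrence in `k`,
thanks to non-laziness; hence `‖U^k_ℓ g‖² ≈ ‖g‖² / R(k,ℓ)`. -/
theorem IsEposet.abs_nrm_upIter_sq_sub_le (hX : IsRegularPoset X d) (hw : IsMeasured X d wt)
    (hE : IsEposet X d wt δ γ) (hN : IsNonLazy X d wt γ) {l k : ℕ} (h : l ≤ k) (hk : k ≤ d)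
    {g : Cochain X l} (hg : g ∈ kerSpace wt l) :
    |nrm wt (upIter h g) ^ 2 - (regularity X k l : ℝ)⁻¹ * nrm wt g ^ 2|
      ≤ γ * (k * (k + 2)) * nrm wt g ^ 2 := by
  classical
  obtain ⟨s⟩ := hw.nonempty (h.trans hk)
  have hs := hw.pos s.1
  have hγ := hE.gamma_nonneg
  have hn : nrm wt (Pi.single s (1 : ℝ)) * nrm wt (Pi.single s (1 : ℝ)) = wt s.1 := by
    rw [← sq, hw.nrm_sq, ip_single_self]
  -- to avoid divisions, both sides are multiplied by `π(s)`
  have main : |ip wt (upIter h g) (upIter h g) * wt s.1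
      - ip wt (upIter h (Pi.single s (1 : ℝ))) (upIter h (Pi.single s (1 : ℝ))) * nrm wt g ^ 2|
      ≤ γ * (k * (k + 2)) * (nrm wt g ^ 2 * wt s.1) := by
    induction k, h using Nat.le_induction with
    | base =>
      simp only [upIter_self]
      rw [ip_single_self, ← hw.nrm_sq, mul_comm, sub_self, abs_zero]
      positivity
    | succ m h ih =>
      have ih := ih (by omega)
      have h1 := hE.abs_ip_upIter_succ_sub_le hX hw h h hk g g
      have h2 := hE.abs_ip_upIter_succ_sub_le hX hw h h hk (Pi.single s (1 : ℝ))
        (Pi.single s (1 : ℝ))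
      have hq := hN.ip_upIter_lowerWalk_single_mem hX hw hγ h (Nat.le_of_succ_le hk) s
      rw [lowerWalk_eq_zero hg, map_zero] at h1
      have h0 : ip wt (0 : Cochain X m) (upIter h g) = 0 := by simp [ip]
      rw [h0, mul_zero, add_zero, ← sq] at h1
      rw [hn] at h2
      have hp := hE.prod_mem_Icc (l := l) hk
      generalize ip wt (upIter (Nat.le_succ_of_le h) g) (upIter (Nat.le_succ_of_le h) g) = A' at *
      generalize ip wt (upIter (Nat.le_succ_of_le h) (Pi.single s (1 : ℝ)))
        (upIter (Nat.le_succ_of_le h) (Pi.single s (1 : ℝ))) = B' at *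
      generalize ip wt (upIter h g) (upIter h g) = A at *
      generalize ip wt (upIter h (Pi.single s (1 : ℝ))) (upIter h (Pi.single s (1 : ℝ))) = B at *
      generalize ip wt (upIter h (lowerWalk wt l (Pi.single s (1 : ℝ))))
        (upIter h (Pi.single s (1 : ℝ))) = q at *
      generalize ∏ i ∈ Finset.Icc l m, δ i = p at *
      generalize wt s.1 = π at *
      have hG : 0 ≤ nrm wt g ^ 2 := sq_nonneg _
      generalize nrm wt g ^ 2 = G at *
      obtain ⟨hp0, hp1⟩ := hp
      obtain ⟨hq0, hq1⟩ := hq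
      have h3 : |(A' - (1 - p) * A) * π| ≤ γ * (m + 1) * G * π := by
        rw [abs_mul, abs_of_pos hs]
        exact mul_le_mul_of_nonneg_right h1 hs.le
      have h4 : |(B' - ((1 - p) * B + p * q)) * G| ≤ γ * (m + 1) * π * G := by
        rw [abs_mul, abs_of_nonneg hG]
        exact mul_le_mul_of_nonneg_right h2 hG
      have h5 : |(1 - p) * (A * π - B * G)| ≤ γ * (m * (m + 2)) * (G * π) := by
        rw [abs_mul, abs_of_nonneg (by linarith)]
        exact (mul_le_of_le_one_left (abs_nonneg _) (by linarith)).trans ih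
      have h6 : |p * q * G| ≤ γ * π * G := by
        rw [abs_of_nonneg (by positivity)]
        exact mul_le_mul_of_nonneg_right
          ((mul_le_of_le_one_left hq0 hp1).trans hq1) hG
      have e : A' * π - B' * G = (A' - (1 - p) * A) * π - (B' - ((1 - p) * B + p * q)) * G
          + (1 - p) * (A * π - B * G) - p * q * G := by ring
      rw [e]
      refine le_trans (abs_sub _ _) (le_trans (add_le_add_left ((abs_add_le _ _).trans
        (add_le_add_left (abs_sub _ _) _)) _) ?_)
      push_cast
      linarith
  rw [ip_upIter_single hX hw h hk, ← hw.nrm_sq] at main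
  refine le_of_mul_le_mul_right ?_ hs
  have e : (nrm wt (upIter h g) ^ 2 - (regularity X k l : ℝ)⁻¹ * nrm wt g ^ 2) * wt s.1
      = nrm wt (upIter h g) ^ 2 * wt s.1 - (regularity X k l : ℝ)⁻¹ * wt s.1 * nrm wt g ^ 2 := by
    ring
  calc _ = |(nrm wt (upIter h g) ^ 2 - (regularity X k l : ℝ)⁻¹ * nrm wt g ^ 2) * wt s.1| := by
        rw [abs_mul, abs_of_pos hs]
    _ ≤ γ * (k * (k + 2)) * (nrm wt g ^ 2 * wt s.1) := e ▸ main
    _ = _ := by ring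

theorem IsEposet.nrm_le_nrm_upIter (hX : IsRegularPoset X d) (hw : IsMeasured X d wt)
    (hE : IsEposet X d wt δ γ) (hN : IsNonLazy X d wt γ) {l k : ℕ} (h : l ≤ k) (hk : k ≤ d)
    (hγ : γ * (k * (k + 2)) * regularity X k l ≤ 1 / 2) {g : Cochain X l}
    (hg : g ∈ kerSpace wt l) :
    nrm wt g ^ 2 ≤ 2 * regularity X k l * nrm wt (upIter h g) ^ 2 := by
  have hR : (0 : ℝ) < regularity X k l := zero_lt_one.trans_le (one_le_regularity hX hw h hk)
  have h1 := (abs_le.1 (hE.abs_nrm_upIter_sq_sub_le hX hw hN h hk hg)).1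
  have hG : 0 ≤ nrm wt g ^ 2 := sq_nonneg _
  generalize nrm wt g ^ 2 = G at *
  generalize nrm wt (upIter h g) ^ 2 = F at *
  have h2 := mul_le_mul_of_nonneg_left h1 hR.le
  have h3 := mul_le_mul_of_nonneg_right hγ hG
  have h4 : (regularity X k l : ℝ) * (F - (regularity X k l : ℝ)⁻¹ * G)
      = regularity X k l * F - G := by field_simp
  rw [h4] at h2
  linarith

/-! ### Approximate eigenspaces of operators on inner product spaces -/

section Approx

variable {E : Type*} [NormedAddCommGroup E] [InnerProductSpace ℝ E] {ι : Type*} [Fintype ι]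

/-- The triangle inequality in the reverse direction for an approximately orthogonal family. -/
theorem sum_norm_sq_le_of_approx_orthogonal (v : ι → E) {ε : ℝ} (hε : 0 ≤ ε)
    (hv : ∀ i j, i ≠ j → |inner ℝ (v i) (v j)| ≤ ε * (‖v i‖ * ‖v j‖))
    (hc : Fintype.card ι * ε ≤ 1 / 2) : ∑ i, ‖v i‖ ^ 2 ≤ 2 * ‖∑ i, v i‖ ^ 2 := by
  classical
  have h1 : ∀ i j, (if i = j then ‖v i‖ ^ 2 else 0) - ε * (‖v i‖ * ‖v j‖)
      ≤ inner ℝ (v i) (v j) := by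
    intro i j
    split_ifs with h
    · subst h
      rw [real_inner_self_eq_norm_sq]
      have : 0 ≤ ε * (‖v i‖ * ‖v i‖) := by positivity
      linarith
    · linarith [(abs_le.1 (hv i j h)).1]
  have h2 : ∑ i, ‖v i‖ ^ 2 - ε * (∑ i, ‖v i‖) ^ 2 ≤ ‖∑ i, v i‖ ^ 2 := by
    rw [← real_inner_self_eq_norm_sq, sum_inner]
    simp_rw [inner_sum]
    refine le_trans (le_of_eq ?_)
      (Finset.sum_le_sum fun i _ => Finset.sum_le_sum fun j _ => h1 i j)
    rw [sq (∑ i, ‖v i‖), Finset.sum_mul_sum, Finset.mul_sum]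
    simp only [Finset.sum_sub_distrib, Finset.sum_ite_eq, Finset.mem_univ, if_true,
      Finset.mul_sum]
  have h3 := sq_sum_le_card_mul_sum_sq (s := Finset.univ) (f := fun i => ‖v i‖)
  rw [Finset.card_univ] at h3
  have h4 := mul_le_mul_of_nonneg_left h3 hε
  have h5 := mul_le_mul_of_nonneg_right hc (Finset.sum_nonneg fun i _ => sq_nonneg ‖v i‖ :
    0 ≤ ∑ i, ‖v i‖ ^ 2)
  linarith

/-- If an eigenvector is a sum of approximately orthogonal approximate eigenvectors, then its
eigenvalue is close to one of their approximate eigenvalues. -/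
theorem exists_abs_sub_le_of_approx_orthogonal (T : E →ₗ[ℝ] E) {x : E} {μ : ℝ} (hx : x ≠ 0)
    (hμ : T x = μ • x) (v : ι → E) (hsum : ∑ i, v i = x) (lam : ι → ℝ) {r ρ ε : ℝ} (hε : 0 ≤ ε)
    (hv : ∀ i j, i ≠ j → |inner ℝ (v i) (v j)| ≤ ε * (‖v i‖ * ‖v j‖))
    (hc : Fintype.card ι * ε ≤ 1 / 2) (hT : ∀ i, ‖T (v i) - lam i • v i‖ ≤ r * ‖v i‖)
    (hρ : 0 ≤ ρ) (hr : 2 * Fintype.card ι * r ^ 2 ≤ ρ ^ 2) :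
    ∃ i, v i ≠ 0 ∧ |μ - lam i| ≤ ρ := by
  by_contra! hcon
  obtain ⟨i₀, hi₀⟩ : ∃ i, v i ≠ 0 := by
    by_contra! h
    exact hx (by rw [← hsum, Finset.sum_eq_zero fun i _ => h i])
  have hS : 0 < ∑ i, ‖v i‖ := Finset.sum_pos' (fun i _ => norm_nonneg _)
    ⟨i₀, Finset.mem_univ _, norm_pos_iff.2 hi₀⟩
  have h1 : ρ * ∑ i, ‖v i‖ < ∑ i, ‖(μ - lam i) • v i‖ := by
    rw [Finset.mul_sum]
    refine Finset.sum_lt_sum (fun i _ => ?_) ⟨i₀, Finset.mem_univ _, ?_⟩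
    · rw [norm_smul, Real.norm_eq_abs]
      by_cases h : v i = 0
      · simp [h]
      · exact mul_le_mul_of_nonneg_right (hcon i h).le (norm_nonneg _)
    · rw [norm_smul, Real.norm_eq_abs]
      exact mul_lt_mul_of_pos_right (hcon i₀ hi₀) (norm_pos_iff.2 hi₀)
  have h2 : ‖∑ i, (μ - lam i) • v i‖ ≤ r * ∑ i, ‖v i‖ := by
    have : ∑ i, (μ - lam i) • v i = ∑ i, (T (v i) - lam i • v i) := by
      simp only [sub_smul, Finset.sum_sub_distrib]
      rw [← Finset.smul_sum, ← map_sum, hsum, hμ]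
    rw [this, Finset.mul_sum]
    exact (norm_sum_le _ _).trans (Finset.sum_le_sum fun i _ => hT i)
  have h3 := sum_norm_sq_le_of_approx_orthogonal (fun i => (μ - lam i) • v i) hε
    (fun i j hij => by
      rw [real_inner_smul_left, real_inner_smul_right, abs_mul, abs_mul, norm_smul, norm_smul,
        Real.norm_eq_abs, Real.norm_eq_abs]
      have := mul_le_mul_of_nonneg_left (hv i j hij)
        (mul_nonneg (abs_nonneg (μ - lam i)) (abs_nonneg (μ - lam j)))
      linarith) hc
  have h4 := sq_sum_le_card_mul_sum_sq (s := Finset.univ) (f := fun i => ‖(μ - lam i) • v i‖)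
  rw [Finset.card_univ] at h4
  have h5 : (ρ * ∑ i, ‖v i‖) ^ 2 < (∑ i, ‖(μ - lam i) • v i‖) ^ 2 :=
    pow_lt_pow_left₀ h1 (by positivity) two_ne_zero
  have h6 : ‖∑ i, (μ - lam i) • v i‖ ^ 2 ≤ (r * ∑ i, ‖v i‖) ^ 2 :=
    pow_le_pow_left₀ (norm_nonneg _) h2 2
  have h7 := mul_le_mul_of_nonneg_left (h3.trans (mul_le_mul_of_nonneg_left h6 zero_le_two))
    (Nat.cast_nonneg (Fintype.card ι) : (0 : ℝ) ≤ _)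
  have h8 := mul_le_mul_of_nonneg_right hr (sq_nonneg (∑ i, ‖v i‖))
  rw [mul_pow] at h5 h7
  linarith

theorem finrank_iSup_le_sum [FiniteDimensional ℝ E] (V : ι → Submodule ℝ E) :
    Module.finrank ℝ (⨆ i, V i : Submodule ℝ E) ≤ ∑ i, Module.finrank ℝ (V i) := by
  classical
  rw [← Finset.sup_univ_eq_iSup]
  induction (Finset.univ : Finset ι) using Finset.induction_on with
  | empty => simp
  | insert a s ha ih =>
    rw [Finset.sup_insert, Finset.sum_insert ha]
    exact (Submodule.finrank_add_le_finrank_add_finrank _ _).trans (Nat.add_le_add_left ih _)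

/-- If the approximate eigenspaces `V_i` of a symmetric operator span the space and their strips
are disjoint, then the strips contain the spectrum: at least `dim V_i` of the vectors of an
orthonormal eigenbasis have their eigenvalue in the strip of `V_i`, so that disjointness leaves none
of them outside of the strips. -/
theorem exists_abs_sub_le_of_disjoint [FiniteDimensional ℝ E] {T : E →ₗ[ℝ] E} (hT : T.IsSymmetric)
    (V : ι → Submodule ℝ E) (hV : ⨆ i, V i = ⊤) (lam r : ι → ℝ)
    (h : ∀ i, ∀ v ∈ V i, ‖T v - lam i • v‖ ≤ r i * ‖v‖)
    (hdisj : ∀ i j, i ≠ j → r i + r j < |lam i - lam j|)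
    {x : E} {μ : ℝ} (hx : x ≠ 0) (hμ : T x = μ • x) : ∃ i, |μ - lam i| ≤ r i := by
  classical
  set n := Module.finrank ℝ E with hn
  set b := hT.eigenvectorBasis hn.symm
  set ev := hT.eigenvalues hn.symm
  have hb : ∀ j, T (b j) = ev j • b j := hT.apply_eigenvectorBasis hn.symm
  have hbT : ∀ j v, inner ℝ (b j) (T v) = ev j * inner ℝ (b j) v := by
    intro j v
    rw [← hT, hb, real_inner_smul_left]
  have hsq : ∀ w : E, ∑ j, inner ℝ (b j) w ^ 2 = ‖w‖ ^ 2 := by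
    intro w
    rw [← b.sum_sq_norm_inner_right w]
    simp only [Real.norm_eq_abs, sq_abs]
  have hzero : ∀ w : E, (∀ j, inner ℝ (b j) w = 0) → w = 0 := by
    intro w hw
    have := hsq w
    simp only [hw] at this
    simpa using this.symm
  set J : ι → Finset (Fin n) := fun i => Finset.univ.filter fun j => |ev j - lam i| ≤ r i
  have hJ : ∀ i, Module.finrank ℝ (V i) ≤ (J i).card := by
    intro i
    let φ : V i →ₗ[ℝ] (J i → ℝ) := LinearMap.pi fun j => (innerₛₗ ℝ (b j)).comp (V i).subtype
    have hφ : Function.Injective φ := by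
      rw [injective_iff_map_eq_zero]
      rintro ⟨v, hvV⟩ hv
      have hv' : ∀ j ∈ J i, inner ℝ (b j) v = 0 := fun j hj => congrFun hv ⟨j, hj⟩
      have hb0 : ∀ j, inner ℝ (b j) v = 0 := by
        by_contra! hcon
        obtain ⟨j₀, hj₀⟩ := hcon
        have hv0 : v ≠ 0 := by rintro rfl; simp at hj₀
        have hr : 0 ≤ r i := nonneg_of_mul_nonneg_left
          ((norm_nonneg _).trans (h i v hvV)) (norm_pos_iff.2 hv0)
        have h1 : ∑ j, (r i * inner ℝ (b j) v) ^ 2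
            < ∑ j, (inner ℝ (b j) (T v - lam i • v)) ^ 2 := by
          have hval : ∀ j, inner ℝ (b j) (T v - lam i • v)
              = (ev j - lam i) * inner ℝ (b j) v := by
            intro j
            rw [inner_sub_right, hbT, real_inner_smul_right]
            ring
          have hout : ∀ j, inner ℝ (b j) v ≠ 0 → r i ^ 2 < (ev j - lam i) ^ 2 := by
            intro j hj
            have : ¬ |ev j - lam i| ≤ r i := fun hle =>
              hj (hv' j (Finset.mem_filter.2 ⟨Finset.mem_univ _, hle⟩))
            rw [sq_lt_sq, abs_of_nonneg hr]
            exact not_le.1 this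
          refine Finset.sum_lt_sum (fun j _ => ?_) ⟨j₀, Finset.mem_univ _, ?_⟩
          · rw [hval, mul_pow, mul_pow]
            by_cases h0 : inner ℝ (b j) v = 0
            · simp [h0]
            · exact mul_le_mul_of_nonneg_right (hout j h0).le (sq_nonneg _)
          · rw [hval, mul_pow, mul_pow]
            exact mul_lt_mul_of_pos_right (hout j₀ hj₀) (by positivity)
        have h2 := pow_le_pow_left₀ (norm_nonneg _) (h i v hvV) 2
        simp only [mul_pow] at h1
        rw [← Finset.mul_sum, hsq, hsq] at h1
        rw [mul_pow] at h2
        linarith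
      refine Subtype.ext (hzero v hb0)
    have := LinearMap.finrank_le_finrank_of_injective hφ
    rwa [Module.finrank_fintype_fun_eq_card, Fintype.card_coe] at this
  have hdJ : Set.PairwiseDisjoint (↑(Finset.univ : Finset ι)) J := by
    intro i _ i' _ hne
    refine Finset.disjoint_left.2 fun j hj hj' => ?_
    have h1 := (Finset.mem_filter.1 hj).2
    have h2 := (Finset.mem_filter.1 hj').2
    have h3 := abs_sub_le (lam i) (ev j) (lam i')
    rw [abs_sub_comm (lam i) (ev j)] at h3
    linarith [hdisj i i' hne]
  have hcard : n ≤ (Finset.univ.biUnion J).card := by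
    rw [Finset.card_biUnion hdJ]
    calc n = Module.finrank ℝ (⨆ i, V i : Submodule ℝ E) := by rw [hV, finrank_top]
      _ ≤ _ := (finrank_iSup_le_sum V).trans (Finset.sum_le_sum fun i _ => hJ i)
  have huniv : Finset.univ.biUnion J = Finset.univ :=
    Finset.eq_univ_of_card _ (le_antisymm (Finset.card_le_univ _) (by simpa using hcard))
  obtain ⟨j, hj⟩ : ∃ j, inner ℝ (b j) x ≠ 0 := by
    by_contra! hcon
    exact hx (hzero x hcon)
  have hj1 : ev j = μ := by
    have := hbT j x
    rw [hμ, real_inner_smul_right] at this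
    exact (mul_right_cancel₀ hj this).symm
  obtain ⟨i, -, hi⟩ := Finset.mem_biUnion.1 (huniv ▸ Finset.mem_univ j : j ∈ Finset.univ.biUnion J)
  exact ⟨i, hj1 ▸ (Finset.mem_filter.1 hi).2⟩

/-- The variant of `exists_abs_sub_le_of_disjoint` where the space is spanned by an eigenvector `e`
of eigenvalue `1` and approximate eigenspaces orthogonal to `e`. -/
theorem exists_abs_sub_le_of_disjoint_of_orthogonal [FiniteDimensional ℝ E] {T : E →ₗ[ℝ] E}
    (hT : T.IsSymmetric) {e : E} (he : ‖e‖ = 1) (hTe : T e = e)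
    (V : ι → Submodule ℝ E) (hVe : ∀ i, ∀ v ∈ V i, inner ℝ e v = 0)
    (hV : Submodule.span ℝ {e} ⊔ ⨆ i, V i = ⊤) (lam r : ι → ℝ) (hr : ∀ i, 0 ≤ r i)
    (h : ∀ i, ∀ v ∈ V i, ‖T v - lam i • v‖ ≤ r i * ‖v‖)
    (hdisj : ∀ i j, i ≠ j → r i + r j < |lam i - lam j|)
    {x : E} {μ : ℝ} (hx : x ≠ 0) (hμ : T x = μ • x) (hμ1 : μ ≠ 1) :
    ∃ i, |μ - lam i| ≤ r i := by
  have hex : inner ℝ e x = 0 := by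
    have := hT e x
    rw [hTe, hμ, real_inner_smul_right] at this
    have h' : (μ - 1) * inner ℝ e x = 0 := by linarith
    exact (mul_eq_zero.1 h').resolve_left (sub_ne_zero.2 hμ1)
  -- the eigenvalue of `e` is moved away from all the strips, and from `μ`
  set c : ℝ := |μ| + ∑ i, (|lam i| + r i) with hc
  have hle : ∀ i, |lam i| + r i ≤ c := fun i =>
    (Finset.single_le_sum (f := fun i => |lam i| + r i)
      (fun j _ => add_nonneg (abs_nonneg _) (hr j)) (Finset.mem_univ i)).trans
      (le_add_of_nonneg_left (abs_nonneg _))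
  have hle' : |μ| ≤ c := le_add_of_nonneg_right
    (Finset.sum_nonneg fun j _ => add_nonneg (abs_nonneg _) (hr j))
  set T' : E →ₗ[ℝ] E := T + c • (innerₛₗ ℝ e).smulRight e with hT'
  have happ : ∀ v, T' v = T v + (c * inner ℝ e v) • e := by
    intro v
    simp [hT', mul_smul]
  have hsym : T'.IsSymmetric := by
    intro u v
    rw [happ, happ, inner_add_left, inner_add_right, hT, real_inner_smul_left,
      real_inner_smul_right, real_inner_comm e u]
    ring
  have hTV : ∀ v, inner ℝ e v = 0 → T' v = T v := by
    intro v hv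
    rw [happ, hv, mul_zero, zero_smul, add_zero]
  obtain ⟨i, hi⟩ := exists_abs_sub_le_of_disjoint hsym
    (fun o : Option ι => o.elim (Submodule.span ℝ {e}) V) (by rw [iSup_option]; exact hV)
    (fun o => o.elim (1 + c) lam) (fun o => o.elim 0 r) (by
      rintro (_ | i) v hv
      · obtain ⟨a, rfl⟩ := Submodule.mem_span_singleton.1 hv
        rw [happ, map_smul, hTe, real_inner_smul_right, real_inner_self_eq_norm_sq, he]
        simp only [Option.elim]
        rw [show a • e + (c * (a * 1 ^ 2)) • e - (1 + c) • a • e = 0 by module]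
        simp
      · rw [hTV v (hVe i v hv)]
        exact h i v hv) (by
      rintro (_ | i) (_ | j) hij
      · exact absurd rfl hij
      · simp only [Option.elim]
        rw [zero_add, lt_abs]
        left
        linarith [hle j, le_abs_self (lam j)]
      · simp only [Option.elim]
        rw [add_zero, lt_abs]
        right
        linarith [hle i, le_abs_self (lam i)]
      · exact hdisj i j fun e => hij (congrArg some e)) hx ((hTV x hex).trans hμ)
  cases i with
  | none =>
    simp only [Option.elim] at hi
    have := (abs_le.1 hi).1
    linarith [le_abs_self μ]
  | some i => exact ⟨i, hi⟩

end Approx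

/-! ### The decomposition of `C_k` -/

/-- `C_k` is the sum of the `V_k^ℓ`: by adjointness, `C_{i+1}` is the orthogonal sum of `ker D_{i+1}`
and the image of `U_i`. -/
theorem exists_sum_upIter_eq (hw : IsMeasured X d wt) {k : ℕ} (hk : k ≤ d) (f : Cochain X k) :
    ∃ g : ∀ l, Cochain X l, (∀ l, g l ∈ kerSpace wt l) ∧
      ∑ l : Fin (k + 1), upIter (Nat.le_of_lt_succ l.2) (g l) = f := by
  induction k with
  | zero =>
    refine ⟨Function.update 0 0 f, fun l => ?_, ?_⟩
    · cases l with
      | zero => exact Submodule.mem_top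
      | succ l =>
        rw [Function.update_of_ne (Nat.succ_ne_zero l)]
        exact Submodule.zero_mem _
    · simp [upIter_self]
  | succ k ih =>
    obtain ⟨a, ⟨f', rfl⟩, b, hb, hab⟩ := (LinearMap.range
      ((toEuclid wt (k + 1)).comp (up k))).exists_add_mem_mem_orthogonal (toEuclid wt (k + 1) f)
    have hb' : b = toEuclid wt (k + 1) (f - up k f') := by
      rw [map_sub, hab]
      simp
    have hker : down wt k (f - up k f') = 0 := by
      apply hw.toEuclid_injective k
      rw [map_zero, ← norm_eq_zero, hw.norm_toEuclid]
      have h0 := (Submodule.mem_orthogonal _ b).1 hb _ ⟨down wt k (f - up k f'), rfl⟩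
      rw [LinearMap.comp_apply, hb', hw.inner_toEuclid, ip_comm, ← ip_down_left hw hk,
        ← hw.nrm_sq] at h0
      exact pow_eq_zero_iff two_ne_zero |>.1 h0
    obtain ⟨g, hg, hsum⟩ := ih (by omega) f'
    refine ⟨Function.update g (k + 1) (f - up k f'), fun l => ?_, ?_⟩
    · by_cases hl : l = k + 1
      · subst hl
        rw [Function.update_self]
        exact hker
      · rw [Function.update_of_ne hl]
        exact hg l
    · rw [Fin.sum_univ_castSucc]
      have h1 : ∀ l : Fin (k + 1), upIter (Nat.le_of_lt_succ l.castSucc.2)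
          (Function.update g (k + 1) (f - up k f') l.castSucc)
            = up k (upIter (Nat.le_of_lt_succ l.2) (g l)) := by
        intro l
        rw [← upIter_succ (Nat.le_of_lt_succ l.2) (l.2.le)]
        simp only [Fin.val_castSucc]
        rw [Function.update_of_ne l.2.ne]
      simp only [h1]
      rw [← map_sum, hsum]
      simp only [Fin.val_last, Function.update_self, upIter_self]
      abel

/-- The consequence of the bound on `γ` that all the estimates below use. -/
theorem IsEposet.gamma_mul_le (hX : IsRegularPoset X d) (hw : IsMeasured X d wt)
    (hE : IsEposet X d wt δ γ) {k : ℕ} (hk1 : 1 ≤ k) (hk : k ≤ d)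
    (hγ : γ ≤ 1 / 8 * (⨆ i : Set.Icc 1 (d - 1), δ i * (1 - δ (i - 1))) /
      ((k : ℝ) ^ 5 * (regularityMax X k : ℝ) ^ 2)) :
    γ * (8 * k ^ 3 * regularityMax X k) ≤ 1 := by
  -- the supremum of the empty family, for `d = 1`, is `0`
  have hsup : (⨆ i : Set.Icc 1 (d - 1), δ i * (1 - δ (i - 1))) ≤ 1 := by
    refine Real.iSup_le (fun i => ?_) zero_le_one
    have hi := i.2
    rw [Set.mem_Icc] at hi
    have h1 := hE.mem_Icc (i := i) (by omega)
    have h2 := hE.mem_Icc (i := (i : ℕ) - 1) (by omega)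
    exact mul_le_one₀ h1.2 (by linarith [h2.2]) (by linarith [h2.1])
  have hR : (1 : ℝ) ≤ regularityMax X k :=
    (one_le_regularity hX hw (le_refl k) hk).trans (regularity_le_max le_rfl)
  have hk' : (1 : ℝ) ≤ k := by exact_mod_cast hk1
  set R : ℝ := (regularityMax X k : ℝ)
  set K : ℝ := (k : ℝ)
  have hpos : 0 < K ^ 5 * R ^ 2 := by positivity
  rw [le_div_iff₀ hpos] at hγ
  have h1 : K ^ 3 * R ≤ K ^ 5 * R ^ 2 :=
    mul_le_mul (pow_le_pow_right₀ hk' (by norm_num))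
      (le_self_pow₀ hR two_ne_zero) (by positivity) (by positivity)
  have h2 := mul_le_mul_of_nonneg_left h1 hE.gamma_nonneg
  linarith

section Small

variable (hX : IsRegularPoset X d) (hw : IsMeasured X d wt) (hE : IsEposet X d wt δ γ)
  (hN : IsNonLazy X d wt γ) {k : ℕ} (hk1 : 1 ≤ k) (hk : k ≤ d)
  (hγ : γ * (8 * k ^ 3 * regularityMax X k) ≤ 1)
include hX hw hE hN hk1 hk hγ

theorem nrm_sq_le_of_small {l : ℕ} (h : l ≤ k) {g : Cochain X l} (hg : g ∈ kerSpace wt l) :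
    nrm wt g ^ 2 ≤ 2 * regularity X k l * nrm wt (upIter h g) ^ 2 := by
  refine hE.nrm_le_nrm_upIter hX hw hN h hk ?_ hg
  have hk' : (1 : ℝ) ≤ k := by exact_mod_cast hk1
  have hR0 : (0 : ℝ) ≤ regularity X k l := Nat.cast_nonneg _
  have h1 : (k : ℝ) * (k + 2) ≤ 4 * k ^ 3 := by
    have h2 : (k : ℝ) ^ 2 ≤ k ^ 3 := pow_le_pow_right₀ hk' (by norm_num)
    have h3 : (k : ℝ) ≤ k ^ 3 := le_self_pow₀ hk' (by norm_num)
    linarith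
  have h2 : (k : ℝ) * (k + 2) * regularity X k l ≤ 4 * k ^ 3 * regularityMax X k :=
    mul_le_mul h1 (regularity_le_max h) hR0 (by positivity)
  have h3 := mul_le_mul_of_nonneg_left h2 hE.gamma_nonneg
  linarith

theorem nrm_le_of_small {l : ℕ} (h : l ≤ k) {g : Cochain X l} (hg : g ∈ kerSpace wt l) :
    nrm wt g ≤ 2 * regularity X k l * nrm wt (upIter h g) := by
  have hR := one_le_regularity hX hw h hk
  refine le_of_sq_le_sq ((nrm_sq_le_of_small hX hw hE hN hk1 hk hγ h hg).trans ?_)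
    (mul_nonneg (by positivity) (nrm_nonneg _))
  rw [mul_pow]
  exact mul_le_mul_of_nonneg_right (le_self_pow₀ (by linarith) two_ne_zero) (sq_nonneg _)

theorem abs_inner_le_of_small {g : ∀ l, Cochain X l} (hg : ∀ l, g l ∈ kerSpace wt l)
    (i j : Fin (k + 1)) (hij : i ≠ j) :
    |inner ℝ (toEuclid wt k (upIter (Nat.le_of_lt_succ i.2) (g i)))
      (toEuclid wt k (upIter (Nat.le_of_lt_succ j.2) (g j)))|
      ≤ γ * k ^ 2 * (2 * regularityMax X k) *
        (‖toEuclid wt k (upIter (Nat.le_of_lt_succ i.2) (g i))‖ *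
          ‖toEuclid wt k (upIter (Nat.le_of_lt_succ j.2) (g j))‖) := by
  wlog h : j < i generalizing i j
  · have := this j i hij.symm (lt_of_le_of_ne (not_lt.1 h) hij)
    rwa [real_inner_comm, mul_comm ‖_‖ ‖_‖] at this
  have h1 : ∀ i : Fin (k + 1), nrm wt (g i) ^ 2 ≤
      2 * regularityMax X k * nrm wt (upIter (Nat.le_of_lt_succ i.2) (g i)) ^ 2 := fun i =>
    (nrm_sq_le_of_small hX hw hE hN hk1 hk hγ (Nat.le_of_lt_succ i.2) (hg i)).trans
      (mul_le_mul_of_nonneg_right (mul_le_mul_of_nonneg_left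
        (regularity_le_max (Nat.le_of_lt_succ i.2)) zero_le_two) (sq_nonneg _))
  rw [hw.inner_toEuclid, hw.norm_toEuclid, hw.norm_toEuclid]
  refine (hE.abs_ip_upIter_le hX hw h (Nat.le_of_lt_succ i.2) hk (hg i) (g j)).trans ?_
  rw [mul_assoc (γ * (k : ℝ) ^ 2)]
  refine mul_le_mul_of_nonneg_left ?_ (mul_nonneg hE.gamma_nonneg (by positivity))
  refine le_of_sq_le_sq ?_ (mul_nonneg (by positivity)
    (mul_nonneg (nrm_nonneg _) (nrm_nonneg _)))
  rw [mul_pow, mul_pow, mul_pow]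
  calc _ ≤ _ := mul_le_mul (h1 i) (h1 j) (sq_nonneg _)
        (mul_nonneg (by positivity) (sq_nonneg _))
    _ = _ := by ring

omit hX hw hN hk in
theorem card_mul_le_of_small :
    (Fintype.card (Fin (k + 1)) : ℝ) * (γ * k ^ 2 * (2 * regularityMax X k)) ≤ 1 / 2 := by
  rw [Fintype.card_fin]
  push_cast
  have hk' : (1 : ℝ) ≤ k := by exact_mod_cast hk1
  have h1 : ((k : ℝ) + 1) * k ^ 2 ≤ 2 * k ^ 3 := by
    nlinarith [mul_nonneg (sub_nonneg.2 hk') (sq_nonneg (k : ℝ))]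
  have h2 := mul_le_mul_of_nonneg_left h1
    (mul_nonneg hE.gamma_nonneg (Nat.cast_nonneg (regularityMax X k)))
  linarith

theorem isInternal_levelSet :
    DirectSum.IsInternal
      (fun l : Fin (k + 1) => levelSet (X := X) wt (Nat.le_of_lt_succ l.2)) := by
  classical
  rw [DirectSum.isInternal_submodule_iff_iSupIndep_and_iSup_eq_top]
  constructor
  · rw [iSupIndep_iff_finsetSum_eq_zero_imp_eq_zero]
    intro s v hv hsum i hi
    have hex : ∀ j : Fin (k + 1), ∃ g ∈ kerSpace (X := X) wt j,
        upIter (Nat.le_of_lt_succ j.2) g = if j ∈ s then v j else 0 := by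
      intro j
      split_ifs with hj
      · exact hv j hj
      · exact ⟨0, Submodule.zero_mem _, map_zero _⟩
    choose g hg hgv using hex
    set G : ∀ l, Cochain X l := fun l => if h : l < k + 1 then g ⟨l, h⟩ else 0
    have hG : ∀ j : Fin (k + 1), G j = g j := fun j => dif_pos j.2
    have hGker : ∀ l, G l ∈ kerSpace wt l := by
      intro l
      by_cases h : l < k + 1
      · simp only [G, dif_pos h]
        exact hg ⟨l, h⟩
      · simp only [G, dif_neg h]
        exact Submodule.zero_mem _
    have h := sum_norm_sq_le_of_approx_orthogonal _
      (mul_nonneg (mul_nonneg hE.gamma_nonneg (by positivity)) (by positivity))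
      (abs_inner_le_of_small hX hw hE hN hk1 hk hγ hGker) (card_mul_le_of_small hE hk1 hγ)
    simp only [hG, hgv] at h
    rw [← map_sum, Finset.sum_ite_mem, Finset.univ_inter, hsum, map_zero, norm_zero] at h
    have h2 := (Finset.sum_eq_zero_iff_of_nonneg (fun i _ => sq_nonneg _)).1
      (le_antisymm (by simpa using h) (Finset.sum_nonneg fun i _ => sq_nonneg _)) i
      (Finset.mem_univ i)
    rw [if_pos hi, pow_eq_zero_iff two_ne_zero, norm_eq_zero] at h2
    exact hw.toEuclid_injective k (h2.trans (map_zero _).symm)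
  · rw [eq_top_iff]
    intro f _
    obtain ⟨g, hg, rfl⟩ := exists_sum_upIter_eq hw hk f
    exact Submodule.sum_mem _ fun l _ => Submodule.mem_iSup_of_mem l
      (Submodule.mem_map_of_mem (hg l))

end Small

/-! ### HD-walks -/

theorem combWeight_nonneg {k : ℕ} (α : Walk k k →₀ ℝ) : 0 ≤ combWeight α :=
  Finset.sum_nonneg fun _ _ => abs_nonneg _

theorem IsEposet.nrm_walk_sub_le (hX : IsRegularPoset X d) (hw : IsMeasured X d wt)
    (hE : IsEposet X d wt δ γ) {k : ℕ} (Y : Walk k k) (hY : Y.top ≤ d) {l : ℕ} (hl : l ≤ k)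
    {g : Cochain X l} (hg : g ∈ kerSpace wt l) :
    nrm wt (Y.op wt (upIter hl g) - Y.eig δ l • upIter hl g) ≤ nrm wt g * Y.eigErr δ γ l ∧
      nrm wt g * Y.eigErr δ γ l ≤ ((Y.height : ℝ) + k) * Y.height * γ * nrm wt g := by
  refine ⟨(hE.nrm_op_sub_le hX hw Y hY hl hg).1 hl, ?_⟩
  have h1 := mul_le_mul_of_nonneg_left (hE.eigErr_le Y hY l) (nrm_nonneg (wt := wt) g)
  have h2 : Y.ups = Y.height := Nat.add_left_cancel Y.add_ups_eq
  rw [h2] at h1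
  linarith

theorem IsEposet.nrm_combOp_sub_le (hX : IsRegularPoset X d) (hw : IsMeasured X d wt)
    (hE : IsEposet X d wt δ γ) {k : ℕ} {α : Walk k k →₀ ℝ} (hα : ∀ Y ∈ α.support, Y.top ≤ d)
    {l : ℕ} (hl : l ≤ k) {g : Cochain X l} (hg : g ∈ kerSpace wt l) :
    nrm wt (combOp wt α (upIter hl g) - combEig δ l α • upIter hl g)
      ≤ ((combHeight α : ℝ) + k) * combHeight α * combWeight α * γ * nrm wt g := by
  have hγ := hE.gamma_nonneg
  have e : combOp wt α (upIter hl g) - combEig δ l α • upIter hl g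
      = ∑ Y ∈ α.support, α Y • (Y.op wt (upIter hl g) - Y.eig δ l • upIter hl g) := by
    simp only [combOp, combEig, Finsupp.sum, LinearMap.sum_apply, LinearMap.smul_apply,
      Finset.sum_smul, smul_sub, Finset.sum_sub_distrib, smul_smul]
  rw [e, ← hw.norm_toEuclid, map_sum]
  refine (norm_sum_le _ _).trans ?_
  have e' : ((combHeight α : ℝ) + k) * combHeight α * combWeight α * γ * nrm wt g
      = ∑ Y ∈ α.support,
        |α Y| * (((combHeight α : ℝ) + k) * combHeight α * γ * nrm wt g) := by
    rw [← Finset.sum_mul, combWeight, Finsupp.sum]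
    ring
  rw [e']
  refine Finset.sum_le_sum fun Y hY => ?_
  rw [hw.norm_toEuclid, hw.nrm_smul]
  refine mul_le_mul_of_nonneg_left ?_ (abs_nonneg _)
  obtain ⟨h1, h2⟩ := hE.nrm_walk_sub_le hX hw Y (hα Y hY) hl hg
  refine (h1.trans h2).trans (mul_le_mul_of_nonneg_right (mul_le_mul_of_nonneg_right ?_ hγ)
    (nrm_nonneg _))
  have hh : (Y.height : ℝ) ≤ combHeight α := by exact_mod_cast Finset.le_sup hY
  exact mul_le_mul (by linarith) hh (by positivity) (by positivity)

theorem ip_one_of_mem_kerSpace (hX : IsRegularPoset X d) (hw : IsMeasured X d wt) {l : ℕ}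
    (hl : l + 1 ≤ d) {g : Cochain X (l + 1)} (hg : g ∈ kerSpace wt (l + 1)) :
    ip wt g (one X (l + 1)) = 0 := by
  have hg' : down wt l g = 0 := hg
  rw [← up_one hX hw hl, ← ip_down_left hw hl, hg']
  simp [ip]

/-- `toEuclid` as a linear equivalence; its inverse divides by `√π`, which is positive. -/
noncomputable def toEuclidEquiv (hw : IsMeasured X d wt) (i : ℕ) :
    Cochain X i ≃ₗ[ℝ] EuclideanSpace ℝ (Level X i) :=
  LinearEquiv.ofBijective (toEuclid wt i) ⟨hw.toEuclid_injective i, fun v =>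
    ⟨fun x => v x / √(wt x.1), by
      ext x
      exact mul_div_cancel₀ _ (Real.sqrt_pos.2 (hw.pos x.1)).ne'⟩⟩

/-- The operator on Euclidean space that corresponds to an operator on `C_k`. -/
noncomputable def conjEuclid (hw : IsMeasured X d wt) {k : ℕ} (M : Module.End ℝ (Cochain X k)) :
    EuclideanSpace ℝ (Level X k) →ₗ[ℝ] EuclideanSpace ℝ (Level X k) :=
  (toEuclidEquiv hw k).conj M

theorem conjEuclid_toEuclid (hw : IsMeasured X d wt) {k : ℕ} (M : Module.End ℝ (Cochain X k))
    (f : Cochain X k) : conjEuclid hw M (toEuclid wt k f) = toEuclid wt k (M f) := by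
  have : toEuclid wt k f = toEuclidEquiv hw k f := rfl
  rw [this, conjEuclid, LinearEquiv.conj_apply_apply, LinearEquiv.symm_apply_apply]
  rfl

theorem conjEuclid_isSymmetric (hw : IsMeasured X d wt) {k : ℕ} {M : Module.End ℝ (Cochain X k)}
    (hM : ∀ f g : Cochain X k, ip wt (M f) g = ip wt f (M g)) :
    (conjEuclid hw M).IsSymmetric := by
  intro u v
  obtain ⟨f, rfl⟩ := (toEuclidEquiv hw k).surjective u
  obtain ⟨g, rfl⟩ := (toEuclidEquiv hw k).surjective v
  change inner ℝ (conjEuclid hw M (toEuclid wt k f)) (toEuclid wt k g)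
    = inner ℝ (toEuclid wt k f) (conjEuclid hw M (toEuclid wt k g))
  rw [conjEuclid_toEuclid, conjEuclid_toEuclid, hw.inner_toEuclid, hw.inner_toEuclid, hM]

/-- A function orthogonal to the constants has no component in `V_k^0`, as the other `V_k^ℓ` are
orthogonal to the constants. -/
theorem upIter_zero_eq_zero_of_ip_one (hX : IsRegularPoset X d) (hw : IsMeasured X d wt) {k : ℕ}
    (hk : k ≤ d) {g : ∀ l, Cochain X l} (hg : ∀ l, g l ∈ kerSpace wt l)
    (h : ip wt (∑ l : Fin (k + 1), upIter (Nat.le_of_lt_succ l.2) (g l)) (one X k) = 0) :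
    g 0 = 0 := by
  obtain ⟨x₀⟩ := hw.nonempty (Nat.zero_le d)
  rw [← hw.inner_toEuclid, map_sum, sum_inner, Fin.sum_univ_succ] at h
  simp only [hw.inner_toEuclid] at h
  rw [Finset.sum_eq_zero, add_zero] at h
  · have h1 := ip_upIter_one hw (Nat.zero_le k) hk (g 0)
    have h2 : ip wt (g 0) (one X 0) = 0 := h1.symm.trans h
    rw [cochain_zero_eq_smul_one hX (g 0) x₀, ip_smul_left, hw.ip_one_one (Nat.zero_le d),
      mul_one] at h2
    rw [cochain_zero_eq_smul_one hX (g 0) x₀, h2, zero_smul]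
  · intro i _
    have hi : (i : ℕ) + 1 ≤ k := i.2
    exact (ip_upIter_one hw hi hk (g (i + 1))).trans
      (ip_one_of_mem_kerSpace hX hw (hi.trans hk) (hg (i + 1)))

section Spectrum

variable (hX : IsRegularPoset X d) (hw : IsMeasured X d wt) (hE : IsEposet X d wt δ γ)
  (hN : IsNonLazy X d wt γ) {k : ℕ} (hk1 : 1 ≤ k) (hk : k ≤ d)
  (hγ : γ * (8 * k ^ 3 * regularityMax X k) ≤ 1) {α : Walk k k →₀ ℝ}
  (hα : IsHDWalk (X := X) d wt α)
include hX hw hE hN hk1 hk hγ hα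

/-- The elements of `V_k^ℓ` are approximate eigenvectors of HD-walks. -/
theorem nrm_combOp_sub_le_of_small {l : ℕ} (hl : l ≤ k) {g : Cochain X l}
    (hg : g ∈ kerSpace wt l) :
    nrm wt (combOp wt α (upIter hl g) - combEig δ l α • upIter hl g)
      ≤ 2 * (((combHeight α : ℝ) + k) * combHeight α * regularity X k l * combWeight α) * γ *
        nrm wt (upIter hl g) := by
  have hα0 := combWeight_nonneg α
  have hγ0 := hE.gamma_nonneg
  refine (hE.nrm_combOp_sub_le hX hw hα.top_le hl hg).trans ?_
  refine (mul_le_mul_of_nonneg_left (nrm_le_of_small hX hw hE hN hk1 hk hγ hl hg)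
    (by positivity)).trans_eq ?_
  ring

theorem spectrum_subset_of_small :
    spectrum ℝ (combOp (X := X) wt α) ⊆
      {1} ∪ ⋃ l ∈ Set.Icc 1 k, Metric.closedBall (combEig δ l α)
        (4 * (k * ((combHeight α : ℝ) + k) * combHeight α * regularityMax X k *
          combWeight α) * γ) := by
  have hα0 := combWeight_nonneg α
  have hγ0 := hE.gamma_nonneg
  intro μ hμ
  rcases eq_or_ne μ 1 with h1 | h1
  · exact Or.inl h1
  right
  obtain ⟨f, hf⟩ := (Module.End.hasEigenvalue_iff_mem_spectrum.2 hμ).exists_hasEigenvector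
  have hMf := hf.apply_eq_smul
  obtain ⟨g, hg, hsum⟩ := exists_sum_upIter_eq hw hk f
  -- `f` is orthogonal to the constants
  have hf1 : ip wt f (one X k) = 0 := by
    have h := hα.selfAdjoint f (one X k)
    rw [hMf, ip_smul_left, hα.map_one] at h
    have h' : (μ - 1) * ip wt f (one X k) = 0 := by linarith
    exact (mul_eq_zero.1 h').resolve_left (sub_ne_zero.2 h1)
  have hg0 : g 0 = 0 := upIter_zero_eq_zero_of_ip_one hX hw hk hg (hsum ▸ hf1)
  set r : ℝ := 2 * (((combHeight α : ℝ) + k) * combHeight α * regularityMax X k *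
    combWeight α) * γ with hr
  have hr0 : 0 ≤ r := by positivity
  have hk' : (1 : ℝ) ≤ k := by exact_mod_cast hk1
  obtain ⟨i, hi, hle⟩ := exists_abs_sub_le_of_approx_orthogonal
    (conjEuclid hw (combOp wt α)) (x := toEuclid wt k f) (μ := μ)
    (fun h => hf.2 (hw.toEuclid_injective k (h.trans (map_zero _).symm)))
    (by rw [conjEuclid_toEuclid, hMf, map_smul])
    (fun l : Fin (k + 1) => toEuclid wt k (upIter (Nat.le_of_lt_succ l.2) (g l)))
    (by rw [← map_sum, hsum]) (fun l => combEig δ l α) (r := r) (ρ := 2 * k * r)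
    (mul_nonneg (mul_nonneg hγ0 (by positivity)) (by positivity))
    (abs_inner_le_of_small hX hw hE hN hk1 hk hγ hg) (card_mul_le_of_small hE hk1 hγ)
    (fun l => by
      rw [conjEuclid_toEuclid, ← map_smul, ← map_sub, hw.norm_toEuclid, hw.norm_toEuclid]
      have hl := Nat.le_of_lt_succ l.2
      refine (nrm_combOp_sub_le_of_small hX hw hE hN hk1 hk hγ hα hl (hg l)).trans
        (mul_le_mul_of_nonneg_right (mul_le_mul_of_nonneg_right (mul_le_mul_of_nonneg_left
          (mul_le_mul_of_nonneg_right (mul_le_mul_of_nonneg_left (regularity_le_max hl)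
            (by positivity)) hα0) zero_le_two) hγ0) (nrm_nonneg _)))
    (by positivity) (by
      rw [Fintype.card_fin, mul_pow (2 * (k : ℝ)) r]
      refine mul_le_mul_of_nonneg_right ?_ (sq_nonneg r)
      push_cast
      -- `2 (k + 1) ≤ (2 k)²`, which is where the factor `k` of the radius comes from
      nlinarith)
  have hi0 : (i : ℕ) ≠ 0 := by
    rintro h0
    obtain rfl : i = 0 := Fin.ext h0
    apply hi
    change toEuclid wt k (upIter (Nat.zero_le k) (g 0)) = 0
    rw [hg0, map_zero, map_zero]
  refine Set.mem_iUnion₂.2 ⟨i, ⟨Nat.one_le_iff_ne_zero.2 hi0, Nat.le_of_lt_succ i.2⟩, ?_⟩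
  rw [Metric.mem_closedBall, Real.dist_eq]
  refine hle.trans_eq ?_
  rw [hr]
  ring

theorem spectrum_subset_of_small_of_disjoint
    (hdisj : ∀ l ∈ Set.Icc 1 k, ∀ l' ∈ Set.Icc 1 k, l ≠ l' →
      4 * (((combHeight α : ℝ) + k) * combHeight α * regularity X k l * combWeight α) * γ +
        4 * (((combHeight α : ℝ) + k) * combHeight α * regularity X k l' * combWeight α) * γ
      < |combEig δ l α - combEig δ l' α|) :
    spectrum ℝ (combOp (X := X) wt α) ⊆
      {1} ∪ ⋃ l ∈ Set.Icc 1 k, Metric.closedBall (combEig δ l α)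
        (4 * (((combHeight α : ℝ) + k) * combHeight α * regularity X k l * combWeight α) * γ) := by
  have hα0 := combWeight_nonneg α
  have hγ0 := hE.gamma_nonneg
  intro μ hμ
  rcases eq_or_ne μ 1 with h1 | h1
  · exact Or.inl h1
  right
  obtain ⟨f, hf⟩ := (Module.End.hasEigenvalue_iff_mem_spectrum.2 hμ).exists_hasEigenvector
  have hMf := hf.apply_eq_smul
  -- index `i` stands for `V_k^{i+1}`
  have hl : ∀ i : Fin k, (i : ℕ) + 1 ∈ Set.Icc 1 k := fun i => ⟨by omega, i.2⟩
  obtain ⟨i, hi⟩ := exists_abs_sub_le_of_disjoint_of_orthogonal (ι := Fin k)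
    (conjEuclid_isSymmetric hw hα.selfAdjoint) (e := toEuclid wt k (one X k))
    (by rw [hw.norm_toEuclid, nrm, hw.ip_one_one hk, Real.sqrt_one])
    (by rw [conjEuclid_toEuclid, hα.map_one])
    (fun i => (levelSet (X := X) wt (hl i).2).map (toEuclid wt k))
    (by
      rintro i _ ⟨_, ⟨g, hg, rfl⟩, rfl⟩
      rw [hw.inner_toEuclid, ip_comm, ip_upIter_one hw (hl i).2 hk]
      exact ip_one_of_mem_kerSpace hX hw ((hl i).2.trans hk) hg)
    (by
      rw [eq_top_iff]
      intro v _
      obtain ⟨f, rfl⟩ := (toEuclidEquiv hw k).surjective v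
      obtain ⟨g, hg, rfl⟩ := exists_sum_upIter_eq hw hk f
      obtain ⟨x₀⟩ := hw.nonempty (Nat.zero_le d)
      change toEuclid wt k _ ∈ _
      rw [Fin.sum_univ_succ, map_add, map_sum]
      refine Submodule.add_mem_sup ?_ (Submodule.sum_mem _ fun i _ =>
        Submodule.mem_iSup_of_mem i (Submodule.mem_map_of_mem (Submodule.mem_map_of_mem (hg _))))
      refine Submodule.mem_span_singleton.2 ⟨g 0 x₀, ?_⟩
      change _ = toEuclid wt k (upIter (Nat.zero_le k) (g 0))
      rw [cochain_zero_eq_smul_one hX (g 0) x₀, map_smul, map_smul, upIter_one hX hw _ hk]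
      simp)
    (fun i => combEig δ (i + 1) α)
    (fun i => 4 * (((combHeight α : ℝ) + k) * combHeight α * regularity X k (i + 1) *
      combWeight α) * γ)
    (fun i => by positivity)
    (by
      rintro i _ ⟨_, ⟨g, hg, rfl⟩, rfl⟩
      rw [conjEuclid_toEuclid, ← map_smul, ← map_sub, hw.norm_toEuclid, hw.norm_toEuclid]
      refine (nrm_combOp_sub_le_of_small hX hw hE hN hk1 hk hγ hα (hl i).2 hg).trans
        (mul_le_mul_of_nonneg_right (mul_le_mul_of_nonneg_right (mul_le_mul_of_nonneg_right
          (by norm_num) (by positivity)) hγ0) (nrm_nonneg _)))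
    (fun i j hij => hdisj _ (hl i) _ (hl j) fun h => hij (Fin.ext (Nat.succ_injective h)))
    (x := toEuclid wt k f)
    (fun h => hf.2 (hw.toEuclid_injective k (h.trans (map_zero _).symm)))
    (by rw [conjEuclid_toEuclid, hMf, map_smul]) h1
  exact Set.mem_iUnion₂.2 ⟨i + 1, hl i, by rwa [Metric.mem_closedBall, Real.dist_eq]⟩

end Spectrum

end EPoset

open EPoset

theorem mainTheorem2 :
    ∃ c₀ C : ℝ, 0 < c₀ ∧ 0 < C ∧
      ∀ (X : Type*) [Fintype X] [PartialOrder X] [GradeMinOrder ℕ X]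
        (d : ℕ) (wt : X → ℝ) (δ : ℕ → ℝ) (γ : ℝ),
        IsRegularPoset X d → IsMeasured X d wt → IsEposet X d wt δ γ →
        ∀ k : ℕ, 1 ≤ k → k ≤ d →
          -- pure walks: approximate eigenvalues and explicit error
          (∀ Y : Walk k k, Y.top ≤ d → ∀ (l : ℕ) (hl : l ≤ k), ∀ g ∈ kerSpace (X := X) wt l,
            nrm wt (Y.op wt (upIter hl g) - Y.eig δ l • upIter hl g)
                ≤ nrm wt g * Y.eigErr δ γ l ∧
              nrm wt g * Y.eigErr δ γ l
                ≤ ((Y.height : ℝ) + k) * Y.height * γ * nrm wt g) ∧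
          -- HD-walks on non-lazy eposets with small `γ`
          (IsNonLazy X d wt γ →
            γ ≤ c₀ * (⨆ i : Set.Icc 1 (d - 1), δ i * (1 - δ (i - 1))) /
              ((k : ℝ) ^ 5 * (regularityMax X k : ℝ) ^ 2) →
            -- the decomposition `C_k = V_k^0 ⊕ ⋯ ⊕ V_k^k`
            DirectSum.IsInternal
                (fun l : Fin (k + 1) => levelSet (X := X) wt (Nat.le_of_lt_succ l.2)) ∧
            ∀ α : Walk k k →₀ ℝ, IsHDWalk (X := X) d wt α →
              -- its elements are approximate eigenvectors
              (∀ (l : ℕ) (hl : l ≤ k), ∀ g ∈ kerSpace (X := X) wt l,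
                nrm wt (combOp wt α (upIter hl g) - combEig δ l α • upIter hl g)
                  ≤ C * (((combHeight α : ℝ) + k) * combHeight α * regularity X k l *
                      combWeight α) * γ * nrm wt (upIter hl g)) ∧
              -- the strips of the spectrum, if they are disjoint
              ((∀ l ∈ Set.Icc 1 k, ∀ l' ∈ Set.Icc 1 k, l ≠ l' →
                  C * (((combHeight α : ℝ) + k) * combHeight α * regularity X k l *
                      combWeight α) * γ +
                    C * (((combHeight α : ℝ) + k) * combHeight α * regularity X k l' *
                      combWeight α) * γ
                  < |combEig δ l α - combEig δ l' α|) →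
                spectrum ℝ (combOp (X := X) wt α) ⊆
                  {1} ∪ ⋃ l ∈ Set.Icc 1 k, Metric.closedBall (combEig δ l α)
                    (C * (((combHeight α : ℝ) + k) * combHeight α * regularity X k l *
                      combWeight α) * γ)) ∧
              -- the strips of the spectrum in general
              spectrum ℝ (combOp (X := X) wt α) ⊆
                {1} ∪ ⋃ l ∈ Set.Icc 1 k, Metric.closedBall (combEig δ l α)
                  (C * (k * ((combHeight α : ℝ) + k) * combHeight α * regularityMax X k *
                    combWeight α) * γ)) := by
  -- `c₀ = 1 / 8` makes `‖g‖ ≤ 2 R(k,ℓ) ‖U^k_ℓ g‖` and `∑ ‖f_ℓ‖² ≤ 2 ‖∑ f_ℓ‖²` available; the former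
  -- contributes a factor `2` to `C`, and `√(2 (k + 1)) ≤ 2 k` from the latter another `2`
  refine ⟨1 / 8, 4, by norm_num, by norm_num, ?_⟩
  intro X _ _ _ d wt δ γ hX hw hE k hk1 hk
  refine ⟨fun Y hY l hl g hg => hE.nrm_walk_sub_le hX hw Y hY hl hg, fun hN hγ => ?_⟩
  have hγ' := hE.gamma_mul_le hX hw hk1 hk hγ
  refine ⟨isInternal_levelSet hX hw hE hN hk1 hk hγ', fun α hα => ⟨fun l hl g hg => ?_,
    spectrum_subset_of_small_of_disjoint hX hw hE hN hk1 hk hγ' hα,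
    spectrum_subset_of_small hX hw hE hN hk1 hk hγ' hα⟩⟩
  have hα0 := combWeight_nonneg α
  refine (nrm_combOp_sub_le_of_small hX hw hE hN hk1 hk hγ' hα hl hg).trans
    (mul_le_mul_of_nonneg_right (mul_le_mul_of_nonneg_right (mul_le_mul_of_nonneg_right
      (by norm_num) (by positivity)) hE.gamma_nonneg) (nrm_nonneg _))
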